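/- Let $M$ be a Hausdorff smooth manifold without boundary, of finite dimension $d$. Let $\mathrm{UConf}(M)=\bigsqcup_{k\ge 0}\mathrm{UConf}_k(M)$, where $\mathrm{UConf}_k(M)$ is the set of subsets of $M$ with exactly $k$ elements, with the smooth structure for which the quotient map $(x_1,\dots,x_k)\mapsto\{x_1,\dots,x_k\}$ from the open set of $k$-tuples of distinct points of $M^k$ is a local diffeomorphism. A vector bundle over $\mathrm{UConf}(M)$ is a family of smooth real vector bundles of finite rank, one over each component $\mathrm{UConf}_k(M)$. * The density bundle $\mathrm{Dens}_B$ of a manifold $B$ has as fibre over $b$ the line of densities on $T_bB$, i.e. of real functions $\nu$ of a basis with $\nu(Av)=|\det A|\,\nu(v)$ for all $A\in \mathrm{GL}(T_bB)$; $\mathrm{Dens}_{\mathrm{UConf}(M)}=\bigsqcup_k \mathrm{Dens}_{\mathrm{UConf}_k(M)}$. * The Cauchy tensor product of vector bundles $A,B$ over $\mathrm{UConf}(M)$ is the bundle with fibres $(A\boxtimes B)_{x}=\bigoplus_{x=y\sqcup z}A_{y}\otimes B_{z}$, the sum being over ordered pairs $(y,z)$ of disjoint configurations with union $x$; its unit $I_\boxtimes$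 is $\mathbb{R}$ over $\emptyset$ and $0$ elsewhere. A commutative $\boxtimes$-algebra bundle is a bundle $A$ with smooth bundle maps $A\boxtimes A\to A$ and $I_\boxtimes\to A$ satisfying associativity, unitality and commutativity. * The Cauchy symmetric bundle $\mathbf{S}^\boxtimes(V)$ of a vector bundle $V\to M$ is the bundle over $\mathrm{UConf}(M)$ whose fibre over a configuration $x$ of $k$ points is the quotient of $\bigoplus_{(x_1,\dots,x_k)} V_{x_1}\otimes\cdots\otimes V_{x_k}$, the sum being over all orderings of $x$, by the span of the elements $v_1\otimes\cdots\otimes v_k-v_{\sigma(1)}\otimes\cdots\otimes v_{\sigma(k)}$, $\sigma\in S_k$. Concatenation of tensors induces its commutative product $\boxdot$, with components $\mathbf{S}^\boxtimes(V)_y\otimes \mathbf{S}^\boxtimes(V)_z\to \mathbf{S}^\boxtimes(V)_{x}$ for $x=y\sqcup z$, whose unit is the empty tensor over $\emptyset$. **Theorem.** There is an isomorphism of smooth vector bundles over $\mathrm{UConf}(M)$ $$\Phi:\ \mathrm{Dens}_{\mathrm{UConf}(M)}\ \xrightarrow{\ \cong\ }\ \mathbf{S}^\boxtimes(\mathrm{Dens}_M),$$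 and $\mathrm{Dens}_{\mathrm{UConf}(M)}$ is a commutative $\boxtimes$-algebra bundle over $\mathrm{UConf}(M)$, with the algebra structure inherited from $\boxdot$: there is a commutative $\boxtimes$-algebra structure on $\mathrm{Dens}_{\mathrm{UConf}(M)}$ whose product and unit $\Phi$ carries to the product $\boxdot$ and the unit of $\mathbf{S}^\boxtimes(\mathrm{Dens}_M)$. -/

import Mathlib

set_option linter.unusedSectionVars false

open Set Function Topology Filter
open scoped Manifold ContDiff TensorProduct DirectSum

noncomputable section

namespace UConfBundles

universe u v w w'

/-! ### Ordered and unordered configurations -/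

/-- Ordered `k`-point configurations: `k`-tuples of distinct points, with the subspace topology
of `M ^ k`. -/
def OConf (k : ℕ) (M : Type u) : Type u := {f : Fin k → M // Injective f}

/-- Unordered `k`-point configurations: sets of `k` distinct points. -/
def UConf (k : ℕ) (M : Type u) : Type u := {s : Finset M // s.card = k}

/-- The total unordered configuration space, the disjoint union of the `UConf k M`. -/
abbrev Conf (M : Type u) : Type u := Σ k : ℕ, UConf k M

section Configurations

variable {k : ℕ} {M : Type u}

/-- The set of points of a configuration. -/
def Conf.pts (x : Conf M) : Finset M := x.2.1

/-- The empty configuration (the vacuum). -/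
def Conf.empty : Conf M := ⟨0, ⟨∅, rfl⟩⟩

theorem Conf.ext {x y : Conf M} (h : x.pts = y.pts) : x = y := by
  obtain ⟨k, s, rfl⟩ := x
  obtain ⟨l, t, rfl⟩ := y
  change s = t at h
  subst h
  rfl

/-- The quotient map `(x₁, …, x_k) ↦ {x₁, …, x_k}`. -/
def OConf.toUConf (f : OConf k M) : UConf k M :=
  ⟨Finset.univ.map ⟨f.1, f.2⟩, by simp⟩

theorem OConf.mem_toUConf (f : OConf k M) (i : Fin k) : f.1 i ∈ f.toUConf.1 := by
  simp [OConf.toUConf]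

theorem OConf.mem_toUConf_iff (f : OConf k M) (y : M) : y ∈ f.toUConf.1 ↔ ∃ i, f.1 i = y := by
  simp [OConf.toUConf]

/-- The action of a permutation on ordered configurations. -/
def OConf.perm (f : OConf k M) (σ : Equiv.Perm (Fin k)) : OConf k M :=
  ⟨f.1 ∘ σ, f.2.comp σ.injective⟩

theorem OConf.toUConf_perm (f : OConf k M) (σ : Equiv.Perm (Fin k)) :
    (f.perm σ).toUConf = f.toUConf := by
  apply Subtype.ext
  ext y
  rw [OConf.mem_toUConf_iff, OConf.mem_toUConf_iff]
  exact σ.surjective.exists (p := fun i => f.1 i = y) |>.symm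

theorem OConf.exists_perm {f g : OConf k M} (h : f.toUConf = g.toUConf) :
    ∃ σ : Equiv.Perm (Fin k), g = f.perm σ := by
  have hx : ∀ i, ∃ j, f.1 j = g.1 i := fun i => by
    rw [← OConf.mem_toUConf_iff, h]; exact g.mem_toUConf i
  choose τ hτ using hx
  have hinj : Injective τ := fun i j hij => g.2 (by rw [← hτ i, ← hτ j, hij])
  exact ⟨Equiv.ofBijective τ (Finite.injective_iff_bijective.1 hinj),
    Subtype.ext (funext fun i => (hτ i).symm)⟩

theorem OConf.toUConf_surjective : Surjective (OConf.toUConf : OConf k M → UConf k M) := by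
  rintro ⟨s, hs⟩
  let e := (Finset.equivFinOfCardEq hs).symm
  refine ⟨⟨fun i => (e i : M), fun i j hij => e.injective (Subtype.ext hij)⟩, Subtype.ext ?_⟩
  ext y
  refine (OConf.mem_toUConf_iff _ y).trans ⟨?_, fun hy => ⟨e.symm ⟨y, hy⟩, by simp⟩⟩
  rintro ⟨i, rfl⟩
  exact (e i).2

/-- The unordered subconfiguration of `(x₁, …, x_k)` given by a set `I` of indices. -/
def OConf.sub (I : Finset (Fin k)) (f : OConf k M) : UConf I.card M :=
  ⟨I.map ⟨f.1, f.2⟩, Finset.card_map _⟩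

variable [TopologicalSpace M]

instance : TopologicalSpace (OConf k M) :=
  inferInstanceAs (TopologicalSpace {f : Fin k → M // Injective f})

/-- `UConf k M` carries the quotient topology of `OConf k M`. -/
instance : TopologicalSpace (UConf k M) :=
  TopologicalSpace.coinduced OConf.toUConf inferInstance

theorem OConf.continuous_val : Continuous (fun f : OConf k M => f.1) := continuous_subtype_val

theorem OConf.continuous_apply (i : Fin k) : Continuous (fun f : OConf k M => f.1 i) :=
  (_root_.continuous_apply i).comp OConf.continuous_val

theorem OConf.continuous_toUConf : Continuous (OConf.toUConf : OConf k M → UConf k M) :=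
  continuous_coinduced_rng

theorem OConf.continuous_perm (σ : Equiv.Perm (Fin k)) :
    Continuous (fun f : OConf k M => f.perm σ) :=
  Continuous.subtype_mk (continuous_pi fun i => OConf.continuous_apply (σ i)) _

theorem OConf.isOpenMap_toUConf : IsOpenMap (OConf.toUConf : OConf k M → UConf k M) := by
  intro U hU
  have h : OConf.toUConf ⁻¹' (OConf.toUConf '' U) =
      ⋃ σ : Equiv.Perm (Fin k), (fun f : OConf k M => f.perm σ) ⁻¹' U := by
    ext g
    simp only [mem_preimage, mem_image, mem_iUnion]
    constructor
    · rintro ⟨f, hf, hfg⟩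
      obtain ⟨σ, rfl⟩ := OConf.exists_perm hfg.symm
      exact ⟨σ, hf⟩
    · rintro ⟨σ, hσ⟩
      exact ⟨_, hσ, OConf.toUConf_perm g σ⟩
  refine isOpen_coinduced.2 ?_
  rw [h]
  exact isOpen_iUnion fun σ => hU.preimage (OConf.continuous_perm σ)

variable [T2Space M]

/-- Two continuous orderings of the same configurations differ locally by a constant
permutation. -/
theorem OConf.eventually_eq_perm {X : Type*} {F : Filter X} {a b : X → OConf k M}
    {f : OConf k M} {σ : Equiv.Perm (Fin k)} (ha : Tendsto a F (𝓝 f))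
    (hb : Tendsto b F (𝓝 (f.perm σ))) (h : ∀ᶠ x in F, (a x).toUConf = (b x).toUConf) :
    ∀ᶠ x in F, b x = (a x).perm σ := by
  have hne : ∀ i j, j ≠ σ i → ∀ᶠ x in F, (b x).1 i ≠ (a x).1 j := by
    intro i j hij
    have hf : f.1 (σ i) ≠ f.1 j := fun e => hij (f.2 e.symm)
    obtain ⟨u, v, hu, hv, hau, hbv, huv⟩ := t2_separation hf
    filter_upwards [((OConf.continuous_apply i).tendsto _).comp hb (hu.mem_nhds hau),
      ((OConf.continuous_apply j).tendsto _).comp ha (hv.mem_nhds hbv)] with x hx hx'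
    exact huv.ne_of_mem hx hx'
  have hne' : ∀ᶠ x in F, ∀ i j, j ≠ σ i → (b x).1 i ≠ (a x).1 j := by
    simp only [eventually_all]
    exact fun i j hij => hne i j hij
  filter_upwards [h, hne'] with x hx hx'
  obtain ⟨τ, hτ⟩ := OConf.exists_perm hx
  refine Subtype.ext (funext fun i => ?_)
  by_contra hc
  refine hx' i (τ i) (fun e => hc ?_) (by rw [hτ]; rfl)
  rw [hτ]
  change (a x).1 (τ i) = (a x).1 (σ i)
  rw [e]

theorem OConf.isLocalHomeomorph_toUConf :
    IsLocalHomeomorph (OConf.toUConf : OConf k M → UConf k M) := by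
  rw [isLocalHomeomorph_iff_isOpenEmbedding_restrict]
  intro f
  have h : ∀ᶠ p : OConf k M × OConf k M in 𝓝 f ×ˢ 𝓝 f ⊓ 𝓟 {p | p.1.toUConf = p.2.toUConf},
      p.2 = p.1.perm 1 :=
    OConf.eventually_eq_perm (f := f) (σ := 1) (tendsto_fst.mono_left inf_le_left)
      (tendsto_snd.mono_left inf_le_left) (eventually_inf_principal.2 (.of_forall fun _ h => h))
  rw [eventually_inf_principal] at h
  obtain ⟨U, hU, hUU⟩ := mem_prod_same_iff.1 h
  obtain ⟨V, hVU, hV, hfV⟩ := mem_nhds_iff.1 hU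
  refine ⟨V, hV.mem_nhds hfV, ?_⟩
  refine IsOpenEmbedding.of_continuous_injective_isOpenMap
    (OConf.continuous_toUConf.comp continuous_subtype_val) ?_
    (OConf.isOpenMap_toUConf.comp hV.isOpenMap_subtype_val)
  rintro ⟨a, ha⟩ ⟨b, hb⟩ hab
  exact Subtype.ext (show b = a.perm 1 from hUU (mk_mem_prod (hVU ha) (hVU hb)) hab).symm

theorem OConf.isOpenEmbedding_val : IsOpenEmbedding (fun f : OConf k M => f.1) := by
  refine IsOpen.isOpenEmbedding_subtypeVal (?_ : IsOpen {f : Fin k → M | Injective f})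
  have : {f : Fin k → M | Injective f} = ⋂ i, ⋂ j, ⋂ _ : i ≠ j, {f | f i ≠ f j} := by
    ext f
    simp only [mem_iInter]
    exact ⟨fun h i j hij e => hij (h e), fun h i j e => by_contra fun hij => h i j hij e⟩
  rw [this]
  exact isOpen_iInter_of_finite fun i => isOpen_iInter_of_finite fun j =>
    isOpen_iInter_of_finite fun _ => isOpen_ne_fun (_root_.continuous_apply i) (_root_.continuous_apply j)

/-- A choice of ordering of every `k`-point configuration, continuous on an open set. -/
structure LocalOrdering (k : ℕ) (M : Type u) [TopologicalSpace M] where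
  toFun : UConf k M → OConf k M
  toUConf_toFun : ∀ x, (toFun x).toUConf = x
  dom : Set (UConf k M)
  isOpen_dom : IsOpen dom
  continuousOn : ContinuousOn toFun dom

theorem LocalOrdering.exists_mem_dom (x : UConf k M) : ∃ L : LocalOrdering k M, x ∈ L.dom := by
  classical
  obtain ⟨f, rfl⟩ := OConf.toUConf_surjective x
  let e := OConf.isLocalHomeomorph_toUConf.localInverseAt f
  have he : ∀ y ∈ e.source, (e y).toUConf = y := fun y hy =>
    OConf.isLocalHomeomorph_toUConf.apply_localInverseAt_of_mem hy
  refine ⟨⟨fun y => if y ∈ e.source then e y else (OConf.toUConf_surjective y).choose, ?_,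
    e.source, e.open_source, ?_⟩,
    OConf.isLocalHomeomorph_toUConf.apply_self_mem_localInverseAt_source⟩
  · intro y
    split_ifs with h
    · exact he y h
    · exact (OConf.toUConf_surjective y).choose_spec
  · exact e.continuousOn.congr fun y hy => if_pos hy

/-! ### The smooth structure of `UConf k M` -/

variable {E : Type v} [NormedAddCommGroup E] [NormedSpace ℝ E] [ChartedSpace E M]

/-- The chart `(φ₁, …, φ_k) ∘ q⁻¹` of `UConf k M`, for `q⁻¹` the inverse of the quotient map `q`
near the ordered configuration `f`. -/
def confChart (f : OConf k M) (φ : Fin k → OpenPartialHomeomorph M E) :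
    OpenPartialHomeomorph (UConf k M) (Fin k → E) :=
  haveI : Nonempty (OConf k M) := ⟨f⟩
  (OConf.isLocalHomeomorph_toUConf.localInverseAt f).trans
    ((OConf.isOpenEmbedding_val.toOpenPartialHomeomorph _).trans (OpenPartialHomeomorph.pi φ))

instance : ChartedSpace (Fin k → E) (UConf k M) where
  atlas := {c | ∃ (f : OConf k M) (φ : Fin k → OpenPartialHomeomorph M E),
    (∀ i, φ i ∈ atlas E M) ∧ c = confChart f φ}
  chartAt x := confChart (OConf.toUConf_surjective x).choose
    fun i => chartAt E ((OConf.toUConf_surjective x).choose.1 i)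
  mem_chart_source x := by
    generalize_proofs h
    generalize hf : h.choose = f
    have hx : f.toUConf = x := hf ▸ h.choose_spec
    subst hx
    simp [confChart]
  chart_mem_atlas x := ⟨_, _, fun i => chart_mem_atlas E _, rfl⟩

theorem mem_confChart_source {f : OConf k M} {φ : Fin k → OpenPartialHomeomorph M E}
    {y : UConf k M} : y ∈ (confChart f φ).source ↔
      y ∈ (OConf.isLocalHomeomorph_toUConf.localInverseAt f).source ∧
        ∀ i, (OConf.isLocalHomeomorph_toUConf.localInverseAt f y).1 i ∈ (φ i).source := by
  simp [confChart]

theorem confChart_apply (f : OConf k M) (φ : Fin k → OpenPartialHomeomorph M E)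
    (y : UConf k M) (i : Fin k) :
    confChart f φ y i = φ i ((OConf.isLocalHomeomorph_toUConf.localInverseAt f y).1 i) := rfl

/-- Any continuous ordering is, in a chart and up to a permutation, given by the inverse charts
of `M`. -/
theorem eventually_eq_confChart {X : Type*} {F : Filter X} {f : OConf k M}
    {φ : Fin k → OpenPartialHomeomorph M E} {y : UConf k M} (hy : y ∈ (confChart f φ).source)
    {a : X → OConf k M} {g : OConf k M} (ha : Tendsto a F (𝓝 g)) (hg : g.toUConf = y) :
    ∃ σ : Equiv.Perm (Fin k), ∀ᶠ x in F, ∀ i,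
      (a x).1 (σ i) ∈ (φ i).source ∧ confChart f φ (a x).toUConf i = φ i ((a x).1 (σ i)) ∧
      (a x).1 (σ i) = (φ i).symm (confChart f φ (a x).toUConf i) := by
  subst hg
  set e := OConf.isLocalHomeomorph_toUConf.localInverseAt f with he
  have hs := (mem_confChart_source.1 hy).1
  have he' : ∀ y ∈ e.source, (e y).toUConf = y := fun y hy =>
    OConf.isLocalHomeomorph_toUConf.apply_localInverseAt_of_mem hy
  obtain ⟨σ, hσ⟩ := OConf.exists_perm (he' _ hs).symm
  have hq : Tendsto (fun x => (a x).toUConf) F (𝓝 g.toUConf) :=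
    (OConf.continuous_toUConf.tendsto g).comp ha
  have hsrc : ∀ᶠ x in F, (a x).toUConf ∈ (confChart f φ).source :=
    hq ((confChart f φ).open_source.mem_nhds hy)
  have hb : Tendsto (fun x => e (a x).toUConf) F (𝓝 (g.perm σ)) := by
    rw [← hσ]
    exact (e.continuousAt hs).tendsto.comp hq
  refine ⟨σ, ?_⟩
  filter_upwards [hsrc, OConf.eventually_eq_perm ha hb
    (hsrc.mono fun x hx => (he' _ (mem_confChart_source.1 hx).1).symm)] with x hx hx' i
  have h1 := (mem_confChart_source.1 hx).2 i
  have h2 : (e (a x).toUConf).1 i = (a x).1 (σ i) := by rw [hx']; rfl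
  rw [confChart_apply, ← he, h2]
  rw [← he, h2] at h1
  exact ⟨h1, rfl, ((φ i).left_inv h1).symm⟩

instance [IsManifold 𝓘(ℝ, E) ∞ M] : IsManifold 𝓘(ℝ, Fin k → E) ∞ (UConf k M) := by
  refine isManifold_of_contDiffOn _ _ _ ?_
  rintro _ _ ⟨f, φ, hφ, rfl⟩ ⟨f', φ', hφ', rfl⟩ z hz
  simp only [modelWithCornersSelf_coe, modelWithCornersSelf_coe_symm, preimage_id_eq, id_eq,
    range_id, inter_univ] at hz
  set c := confChart f φ with hc
  set c' := confChart f' φ' with hc'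
  obtain ⟨hz1, hz2⟩ : z ∈ c.target ∧ c.symm z ∈ c'.source := by simpa using hz
  set e := OConf.isLocalHomeomorph_toUConf.localInverseAt f with he
  have he' : ∀ y ∈ e.source, (e y).toUConf = y := fun y hy =>
    OConf.isLocalHomeomorph_toUConf.apply_localInverseAt_of_mem hy
  have hsrc : ∀ z ∈ c.target, c.symm z ∈ e.source := fun z hz =>
    (mem_confChart_source.1 (c.map_target hz)).1
  have ha : Tendsto (fun z => e (c.symm z)) (𝓝 z) (𝓝 (e (c.symm z))) :=
    (e.continuousAt (hsrc z hz1)).tendsto.comp (c.continuousAt_symm hz1).tendsto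
  obtain ⟨σ, hσ⟩ := eventually_eq_confChart hz2 ha (he' _ (hsrc z hz1))
  have heq : ∀ᶠ w in 𝓝 z, (c.symm.trans c') w =
      (fun i => φ' i ((φ (σ i)).symm (w (σ i)))) ∧ ∀ i, w (σ i) ∈ ((φ (σ i)).symm.trans (φ' i)).source := by
    filter_upwards [hσ, c.open_target.mem_nhds hz1] with w hw hwt
    have hw1 : ∀ j, w j = φ j ((e (c.symm w)).1 j) := fun j => by
      conv_lhs => rw [← c.right_inv hwt]
      rfl
    have hw2 : ∀ j, (e (c.symm w)).1 j ∈ (φ j).source :=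
      (mem_confChart_source.1 (c.map_target hwt)).2
    have hw3 : ∀ j, (φ j).symm (w j) = (e (c.symm w)).1 j := fun j => by
      rw [hw1 j, (φ j).left_inv (hw2 j)]
    refine ⟨funext fun i => ?_, fun i => ?_⟩
    · have := (hw i).2.1
      rw [he' _ (hsrc w hwt)] at this
      rw [hw3]
      exact this
    · simp only [OpenPartialHomeomorph.trans_source, OpenPartialHomeomorph.symm_source, mem_inter_iff,
        mem_preimage]
      rw [hw3]
      refine ⟨?_, (hw i).1⟩
      rw [hw1]
      exact (φ (σ i)).map_source (hw2 _)
  have hsm : ContDiffAt ℝ ∞ (fun w : Fin k → E => fun i => φ' i ((φ (σ i)).symm (w (σ i)))) z := by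
    refine contDiffAt_pi.2 fun i => ?_
    have hcomp := (contDiffGroupoid ∞ 𝓘(ℝ, E)).compatible (hφ (σ i)) (hφ' i)
    rw [contDiffGroupoid, mem_groupoid_of_pregroupoid] at hcomp
    have h1 : ContDiffOn ℝ ∞ ((φ (σ i)).symm.trans (φ' i)) ((φ (σ i)).symm.trans (φ' i)).source := by
      have := hcomp.1
      simpa [contDiffPregroupoid] using this
    have h2 := (h1.contDiffAt (((φ (σ i)).symm.trans (φ' i)).open_source.mem_nhds
      (heq.self_of_nhds.2 i)))
    exact ContDiffAt.comp (g := fun w => φ' i ((φ (σ i)).symm w))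
      (f := fun w : Fin k → E => w (σ i)) z h2 (contDiff_apply ℝ E (σ i)).contDiffAt
  refine (hsm.congr_of_eventuallyEq (heq.mono fun w hw => ?_)).contDiffWithinAt
  exact hw.1

theorem LocalOrdering.contMDiffAt_apply [IsManifold 𝓘(ℝ, E) ∞ M] (L : LocalOrdering k M)
    {x : UConf k M} (hx : x ∈ L.dom) (i : Fin k) :
    ContMDiffAt 𝓘(ℝ, Fin k → E) 𝓘(ℝ, E) ∞ (fun y => (L.toFun y).1 i) x := by
  obtain ⟨f, φ, hφ, hc⟩ := chart_mem_atlas (Fin k → E) x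
  have hxc := mem_chart_source (Fin k → E) x
  rw [hc] at hxc
  obtain ⟨σ, hσ⟩ := eventually_eq_confChart hxc
    (L.continuousOn.continuousAt (L.isOpen_dom.mem_nhds hx)).tendsto (L.toUConf_toFun x)
  obtain ⟨j, rfl⟩ := σ.surjective i
  simp only [L.toUConf_toFun] at hσ
  have hx1 := hσ.self_of_nhds j
  have hsm : ContMDiffAt 𝓘(ℝ, Fin k → E) 𝓘(ℝ, E) ∞
      (fun y => (φ j).symm (confChart f φ y j)) x := by
    have h1 : ContMDiffAt 𝓘(ℝ, Fin k → E) 𝓘(ℝ, Fin k → E) ∞ (confChart f φ) x :=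
      contMDiffAt_of_mem_maximalAtlas
        (IsManifold.subset_maximalAtlas ⟨f, φ, hφ, rfl⟩) hxc
    have h2 : ContMDiffAt 𝓘(ℝ, Fin k → E) 𝓘(ℝ, E) ∞ (fun w : Fin k → E => w j)
        (confChart f φ x) := (contDiff_apply ℝ E j).contMDiff.contMDiffAt
    have h3 : ContMDiffAt 𝓘(ℝ, E) 𝓘(ℝ, E) ∞ (φ j).symm (confChart f φ x j) :=
      contMDiffAt_symm_of_mem_maximalAtlas (IsManifold.subset_maximalAtlas (hφ j))
        (by rw [hx1.2.1]; exact (φ j).map_source hx1.1)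
    exact h3.comp x (h2.comp x h1)
  exact hsm.congr_of_eventuallyEq (hσ.mono fun y hy => (hy j).2.2)

theorem contMDiffAt_toUConf [IsManifold 𝓘(ℝ, E) ∞ M] {E' : Type*} [NormedAddCommGroup E']
    [NormedSpace ℝ E'] {X : Type*} [TopologicalSpace X] [ChartedSpace E' X]
    {g : X → OConf k M} {x : X}
    (hg : ∀ i, ContMDiffAt 𝓘(ℝ, E') 𝓘(ℝ, E) ∞ (fun y => (g y).1 i) x) :
    ContMDiffAt 𝓘(ℝ, E') 𝓘(ℝ, Fin k → E) ∞ (fun y => (g y).toUConf) x := by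
  have hgc : ContinuousAt g x := by
    rw [OConf.isOpenEmbedding_val.isInducing.continuousAt_iff]
    exact continuousAt_pi.2 fun i => (hg i).continuousAt
  have hqc : ContinuousAt (fun y => (g y).toUConf) x :=
    OConf.continuous_toUConf.continuousAt.comp hgc
  obtain ⟨f, φ, hφ, hc⟩ := chart_mem_atlas (Fin k → E) (g x).toUConf
  have hxc := mem_chart_source (Fin k → E) (g x).toUConf
  rw [hc] at hxc
  obtain ⟨σ, hσ⟩ := eventually_eq_confChart hxc hgc.tendsto rfl
  have h1 : ContMDiffAt 𝓘(ℝ, E') 𝓘(ℝ, Fin k → E) ∞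
      (fun y i => φ i ((g y).1 (σ i))) x := by
    rw [contMDiffAt_pi_space]
    intro i
    exact ContMDiffAt.comp x (contMDiffAt_of_mem_maximalAtlas
      (IsManifold.subset_maximalAtlas (hφ i)) (hσ.self_of_nhds i).1) (hg (σ i))
  have h2 : ContMDiffAt 𝓘(ℝ, E') 𝓘(ℝ, Fin k → E) ∞
      (fun y => confChart f φ (g y).toUConf) x :=
    h1.congr_of_eventuallyEq (hσ.mono fun y hy => funext fun i => (hy i).2.1)
  have h3 : ContMDiffAt 𝓘(ℝ, Fin k → E) 𝓘(ℝ, Fin k → E) ∞ (confChart f φ).symm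
      (confChart f φ (g x).toUConf) :=
    contMDiffAt_symm_of_mem_maximalAtlas
      (IsManifold.subset_maximalAtlas ⟨f, φ, hφ, rfl⟩) ((confChart f φ).map_source hxc)
  refine (h3.comp x h2).congr_of_eventuallyEq ?_
  filter_upwards [hqc ((confChart f φ).open_source.mem_nhds hxc)] with y hy
  exact ((confChart f φ).left_inv hy).symm

theorem LocalOrdering.contMDiffAt_sub [IsManifold 𝓘(ℝ, E) ∞ M] (L : LocalOrdering k M)
    {x : UConf k M} (hx : x ∈ L.dom) (I : Finset (Fin k)) :
    ContMDiffAt 𝓘(ℝ, Fin k → E) 𝓘(ℝ, Fin I.card → E) ∞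
      (fun y => (L.toFun y).sub I) x := by
  have h : ∀ f : OConf k M, f.sub I =
      OConf.toUConf ⟨f.1 ∘ I.orderEmbOfFin rfl, f.2.comp (I.orderEmbOfFin rfl).injective⟩ := by
    intro f
    apply Subtype.ext
    ext y
    refine Iff.trans (Finset.mem_map (f := ⟨f.1, f.2⟩)) (Iff.trans ?_ (OConf.mem_toUConf_iff _ y).symm)
    simp only [Function.Embedding.coeFn_mk, comp_apply]
    constructor
    · rintro ⟨i, hi, rfl⟩
      have : i ∈ Set.range (I.orderEmbOfFin rfl) := by
        rw [Finset.range_orderEmbOfFin]; exact hi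
      obtain ⟨j, rfl⟩ := this
      exact ⟨j, rfl⟩
    · rintro ⟨j, rfl⟩
      exact ⟨_, Finset.orderEmbOfFin_mem I rfl j, rfl⟩
  simp only [h]
  exact contMDiffAt_toUConf fun j => L.contMDiffAt_apply hx _

end Configurations

/-! ### Smooth vector bundles -/

section Bundles

variable {B : Type u} [TopologicalSpace B]

/-- A local frame of a family of vector spaces: finitely many sections (with arbitrary values
outside `dom`) that form a basis of the fibre over each point of the open set `dom`. -/
structure LocalFrame (fib : B → Type w) [∀ x, AddCommGroup (fib x)] [∀ x, Module ℝ (fib x)] where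
  ι : Type
  [fintype : Fintype ι]
  dom : Set B
  isOpen_dom : IsOpen dom
  sec : ι → ∀ x, fib x
  exists_basis : ∀ x ∈ dom, ∃ b : Module.Basis ι ℝ (fib x), ∀ a, b a = sec a x

attribute [instance] LocalFrame.fintype

variable (E : Type v) [NormedAddCommGroup E] [NormedSpace ℝ E] [ChartedSpace E B]

/-- The family of linear maps `φ` is smooth with respect to the local frames `f` and `g`: its
matrix entries are smooth near every point at which both frames are defined. -/
def IsSmoothIn {V : B → Type w} [∀ x, AddCommGroup (V x)] [∀ x, Module ℝ (V x)]
    {W : B → Type w'} [∀ x, AddCommGroup (W x)] [∀ x, Module ℝ (W x)]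
    (φ : ∀ x, V x →ₗ[ℝ] W x) (f : LocalFrame V) (g : LocalFrame W) : Prop :=
  ∀ x ∈ f.dom ∩ g.dom, ∃ c : f.ι → g.ι → B → ℝ,
    (∀ a b, ContMDiffAt 𝓘(ℝ, E) 𝓘(ℝ, ℝ) ∞ (c a b) x) ∧
      ∀ᶠ y in 𝓝 x, ∀ a, φ y (f.sec a y) = ∑ b, c a b y • g.sec b y

/-- The structure of a smooth real vector bundle of finite (locally constant) rank on a family of
vector spaces over a manifold: a cover by local frames with smooth transition matrices. -/
structure BundleStr (fib : B → Type w) [∀ x, AddCommGroup (fib x)] [∀ x, Module ℝ (fib x)] where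
  frames : Set (LocalFrame fib)
  covers : ∀ x, ∃ f ∈ frames, x ∈ f.dom
  compatible : ∀ f ∈ frames, ∀ g ∈ frames, IsSmoothIn E (fun _ => LinearMap.id) f g

/-- A smooth real vector bundle over a manifold `B` modelled on `E`. -/
structure SmoothBundle (B : Type u) [TopologicalSpace B] [ChartedSpace E B] where
  fib : B → Type w
  [addCommGroup : ∀ x, AddCommGroup (fib x)]
  [module : ∀ x, Module ℝ (fib x)]
  str : BundleStr E fib

attribute [instance] SmoothBundle.addCommGroup SmoothBundle.module

/-- A smooth real vector bundle over `UConf(M)`: a collection of vector spaces, one for each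
configuration, with the structure of a smooth vector bundle over each component `UConf k M`. -/
structure ConfBundle (M : Type u) [TopologicalSpace M] [T2Space M] [ChartedSpace E M] where
  fib : Conf M → Type w
  [addCommGroup : ∀ x, AddCommGroup (fib x)]
  [module : ∀ x, Module ℝ (fib x)]
  str : ∀ k, BundleStr (Fin k → E) (fun x : UConf k M => fib ⟨k, x⟩)

attribute [instance] ConfBundle.addCommGroup ConfBundle.module

variable {E} {M : Type u} [TopologicalSpace M] [T2Space M] [ChartedSpace E M]

/-- A fibrewise linear map between bundles over `UConf(M)` is smooth. -/
def ConfBundle.IsSmooth {V : ConfBundle.{u, v, w} E M} {W : ConfBundle.{u, v, w'} E M}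
    (φ : ∀ x, V.fib x →ₗ[ℝ] W.fib x) : Prop :=
  ∀ k, ∀ f ∈ (V.str k).frames, ∀ g ∈ (W.str k).frames,
    IsSmoothIn (Fin k → E) (fun x : UConf k M => φ ⟨k, x⟩) f g

/-- A smooth bundle map over `UConf(M)` (covering the identity). -/
structure ConfBundle.Hom (V : ConfBundle.{u, v, w} E M) (W : ConfBundle.{u, v, w'} E M) where
  toFun : ∀ x, V.fib x →ₗ[ℝ] W.fib x
  smooth : ConfBundle.IsSmooth toFun

/-- An isomorphism of smooth vector bundles over `UConf(M)`. -/
structure ConfBundle.Iso (V : ConfBundle.{u, v, w} E M) (W : ConfBundle.{u, v, w'} E M) where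
  toEquiv : ∀ x, V.fib x ≃ₗ[ℝ] W.fib x
  smooth : ConfBundle.IsSmooth fun x => (toEquiv x).toLinearMap
  smooth_symm : ConfBundle.IsSmooth fun x => (toEquiv x).symm.toLinearMap

end Bundles

/-! ### Densities -/

section Densities

/-- Densities on a finite-dimensional vector space `V`: functions `ν` of a basis with
`ν (A v) = |det A| ν v`. -/
def Density (V : Type w) [AddCommGroup V] [Module ℝ V] :
    Submodule ℝ (Module.Basis (Fin (Module.finrank ℝ V)) ℝ V → ℝ) where
  carrier := {ν | ∀ (A : V ≃ₗ[ℝ] V) v, ν (v.map A) = |LinearMap.det (A : V →ₗ[ℝ] V)| * ν v}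
  add_mem' := fun h h' A v => by simp only [Pi.add_apply, h A v, h' A v]; ring
  zero_mem' := fun A v => by simp
  smul_mem' := fun c ν h A v => by simp only [Pi.smul_apply, h A v, smul_eq_mul]; ring

theorem det_comp_linear {V W : Type*} [AddCommGroup V] [Module ℝ V] [AddCommGroup W] [Module ℝ W]
    {n : ℕ} (b : Module.Basis (Fin n) ℝ W) (L : V →ₗ[ℝ] W) (v : Module.Basis (Fin n) ℝ V)
    (A : V →ₗ[ℝ] V) :
    b.det (fun i => L (A (v i))) = LinearMap.det A * b.det (fun i => L (v i)) := by
  have h := (b.det.compLinearMap L).eq_smul_basis_det v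
  have h1 := congrArg (fun η => η (A ∘ v)) h
  simp only [AlternatingMap.smul_apply, v.det_comp, v.det_self, mul_one, smul_eq_mul] at h1
  rw [mul_comm]
  exact h1

/-- The density `|L^* (β₁ ∧ … ∧ β_d)|`, for `β` the dual basis of `b`. -/
def Density.pull {V W : Type*} [AddCommGroup V] [Module ℝ V] [AddCommGroup W] [Module ℝ W]
    (b : Module.Basis (Fin (Module.finrank ℝ V)) ℝ W) (L : V →ₗ[ℝ] W) : Density V :=
  ⟨fun v => |b.det fun i => L (v i)|, fun A v => by
    rw [← abs_mul, ← det_comp_linear]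
    rfl⟩

theorem Density.exists_basis {V : Type*} [AddCommGroup V] [Module ℝ V] [FiniteDimensional ℝ V]
    (ν : Density V) (v : Module.Basis (Fin (Module.finrank ℝ V)) ℝ V) (hν : ν.1 v ≠ 0) :
    ∃ b : Module.Basis Unit ℝ (Density V), ∀ a, b a = ν := by
  have hli : LinearIndependent ℝ (fun _ : Unit => ν) := by
    rw [linearIndependent_unique_iff]
    intro h
    exact hν (by rw [show ν = 0 from h]; rfl)
  refine ⟨Module.Basis.mk hli ?_, fun a => Module.Basis.mk_apply _ _ _⟩
  rintro μ -
  have : μ = (μ.1 v / ν.1 v) • ν := by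
    apply Subtype.ext
    funext w
    have hw : w = v.map (v.equiv w (Equiv.refl _)) := Module.Basis.eq_of_apply_eq fun i => by
      rw [Module.Basis.map_apply, Module.Basis.equiv_apply, Equiv.refl_apply]
    rw [hw]
    change μ.1 _ = (μ.1 v / ν.1 v) * ν.1 _
    rw [μ.2, ν.2]
    field_simp
  rw [this]
  exact Submodule.smul_mem _ _ (Submodule.subset_span ⟨(), rfl⟩)

variable (E : Type v) [NormedAddCommGroup E] [NormedSpace ℝ E] [FiniteDimensional ℝ E]

theorem contDiff_det : ContDiff ℝ ∞ fun A : E →L[ℝ] E => LinearMap.det (A : E →ₗ[ℝ] E) := by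
  have h : ∀ A : E →L[ℝ] E, LinearMap.det (A : E →ₗ[ℝ] E) =
      ∑ σ : Equiv.Perm (Fin (Module.finrank ℝ E)), (Equiv.Perm.sign σ : ℝ) *
        ∏ i, (Module.finBasis ℝ E).coord (σ i) (A (Module.finBasis ℝ E i)) := by
    intro A
    rw [← LinearMap.det_toMatrix (Module.finBasis ℝ E), Matrix.det_apply']
    simp [LinearMap.toMatrix_apply]
  simp only [h]
  refine ContDiff.sum fun σ _ => contDiff_const.mul (contDiff_prod fun i _ => ?_)
  exact (LinearMap.toContinuousLinearMap ((Module.finBasis ℝ E).coord (σ i))).contDiff.comp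
    (contDiff_id.clm_apply contDiff_const)

variable (B : Type u) [TopologicalSpace B] [ChartedSpace E B] [IsManifold 𝓘(ℝ, E) ∞ B]

/-- Over the chart domain at `x₀`, the frame `|dx¹ ∧ … ∧ dx^d|` of the density bundle. -/
def densFrame (x₀ : B) : LocalFrame (fun x : B => Density (TangentSpace 𝓘(ℝ, E) x)) where
  ι := Unit
  dom := (trivializationAt E (TangentSpace 𝓘(ℝ, E)) x₀).baseSet
  isOpen_dom := (trivializationAt E (TangentSpace 𝓘(ℝ, E)) x₀).open_baseSet
  sec _ x := Density.pull (V := TangentSpace 𝓘(ℝ, E) x) (W := E) (Module.finBasis ℝ E)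
    ((trivializationAt E (TangentSpace 𝓘(ℝ, E)) x₀).linearMapAt ℝ x)
  exists_basis x hx := by
    have : FiniteDimensional ℝ (TangentSpace 𝓘(ℝ, E) x) := inferInstanceAs (FiniteDimensional ℝ E)
    let L := (trivializationAt E (TangentSpace 𝓘(ℝ, E)) x₀).linearEquivAt ℝ x hx
    have hL : ((trivializationAt E (TangentSpace 𝓘(ℝ, E)) x₀).linearMapAt ℝ x) = L.toLinearMap :=
      (trivializationAt E (TangentSpace 𝓘(ℝ, E)) x₀).linearMapAt_def_of_mem hx
    obtain ⟨b, hb⟩ := Density.exists_basis (V := TangentSpace 𝓘(ℝ, E) x)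
      (Density.pull (V := TangentSpace 𝓘(ℝ, E) x) (W := E) (Module.finBasis ℝ E) L.toLinearMap)
      ((Module.finBasis ℝ E).map L.symm) (by
        change |(Module.finBasis ℝ E).det fun i => L (((Module.finBasis ℝ E).map L.symm) i)| ≠ 0
        simp only [Module.Basis.map_apply, LinearEquiv.apply_symm_apply]
        rw [Module.Basis.det_self]
        simp)
    refine ⟨b, fun a => ?_⟩
    rw [hb, hL]

/-- The density bundle of a manifold `B`, with fibres the densities on the tangent spaces. -/
def densBundle : SmoothBundle.{u, v, v} E B where
  fib x := Density (TangentSpace 𝓘(ℝ, E) x)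
  str :=
    { frames := range (densFrame E B)
      covers := fun x => ⟨_, mem_range_self x, mem_baseSet_trivializationAt E _ x⟩
      compatible := by
        rintro _ ⟨x₀, rfl⟩ _ ⟨x₁, rfl⟩ x ⟨hx₀, hx₁⟩
        set e₀ := trivializationAt E (TangentSpace 𝓘(ℝ, E) : B → Type v) x₀ with he₀
        set e₁ := trivializationAt E (TangentSpace 𝓘(ℝ, E) : B → Type v) x₁ with he₁
        change x ∈ e₀.baseSet at hx₀
        change x ∈ e₁.baseSet at hx₁
        have hU : e₁.baseSet ∩ e₀.baseSet ∈ 𝓝 x :=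
          (e₁.open_baseSet.inter e₀.open_baseSet).mem_nhds ⟨hx₁, hx₀⟩
        have h1 : ContMDiffAt 𝓘(ℝ, E) 𝓘(ℝ, E →L[ℝ] E) ∞
            (fun y => (e₁.coordChangeL ℝ e₀ y : E →L[ℝ] E)) x :=
          (contMDiffOn_coordChangeL (n := ∞) (IB := 𝓘(ℝ, E)) e₁ e₀).contMDiffAt hU
        have h2 : ContMDiffAt 𝓘(ℝ, E) 𝓘(ℝ, ℝ) ∞
            (fun y => LinearMap.det ((e₁.coordChangeL ℝ e₀ y : E →L[ℝ] E) : E →ₗ[ℝ] E)) x :=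
          (contDiff_det E).contMDiff.contMDiffAt.comp x h1
        have hne : LinearMap.det ((e₁.coordChangeL ℝ e₀ x : E →L[ℝ] E) : E →ₗ[ℝ] E) ≠ 0 :=
          (LinearEquiv.isUnit_det' (e₁.coordChangeL ℝ e₀ x).toLinearEquiv).ne_zero
        refine ⟨fun _ _ y => |LinearMap.det ((e₁.coordChangeL ℝ e₀ y : E →L[ℝ] E) : E →ₗ[ℝ] E)|,
          fun _ _ => ?_, ?_⟩
        · exact (contDiffAt_abs hne).contMDiffAt.comp x h2
        · filter_upwards [hU] with y hy a
          refine Eq.trans ?_ (Fintype.sum_unique (ι := Unit) _).symm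
          apply Subtype.ext
          funext v
          have hC : ∀ w : TangentSpace 𝓘(ℝ, E) y, e₀.linearMapAt ℝ y w =
              (e₁.coordChangeL ℝ e₀ y : E →L[ℝ] E) (e₁.linearMapAt ℝ y w) := by
            intro w
            rw [e₀.linearMapAt_def_of_mem hy.2, e₁.linearMapAt_def_of_mem hy.1]
            change _ = e₁.coordChangeL ℝ e₀ y _
            rw [e₁.coe_coordChangeL e₀ hy, LinearEquiv.trans_apply]
            exact congrArg _ (LinearEquiv.symm_apply_apply (e₁.linearEquivAt ℝ y hy.1) w).symm
          change |(Module.finBasis ℝ E).det fun i => e₀.linearMapAt ℝ y (v i)| = _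
          simp only [hC]
          change _ = |LinearMap.det _| * |(Module.finBasis ℝ E).det fun i => e₁.linearMapAt ℝ y (v i)|
          rw [← abs_mul, ← Module.Basis.det_comp]
          rfl }

variable (M : Type u) [TopologicalSpace M] [T2Space M] [ChartedSpace E M] [IsManifold 𝓘(ℝ, E) ∞ M]

/-- The density bundle of `UConf(M)`: over each component, the density bundle of the manifold
`UConf k M`. -/
def densConfBundle : ConfBundle.{u, v, v} E M where
  fib x := (densBundle (Fin x.1 → E) (UConf x.1 M)).fib x.2
  str k := (densBundle (Fin k → E) (UConf k M)).str

end Densities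

/-! ### The Cauchy tensor product -/

section Cauchy

variable {M : Type u}

open scoped Classical in
/-- `x` is the disjoint union of the configurations `y` and `z`. -/
def IsSplit (x y z : Conf M) : Prop := Disjoint y.pts z.pts ∧ y.pts ∪ z.pts = x.pts

theorem IsSplit.symm {x y z : Conf M} (h : IsSplit x y z) : IsSplit x z y := by
  classical
  exact ⟨h.1.symm, by rw [Finset.union_comm]; exact h.2⟩

/-- The ordered splits of a configuration into two disjoint configurations. -/
@[ext]
structure Split (x : Conf M) where
  fst : Conf M
  snd : Conf M
  isSplit : IsSplit x fst snd

instance (x : Conf M) : DecidableEq (Split x) := Classical.decEq _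

/-- The fibre `⨁ V_y ⊗ W_z` of the Cauchy tensor product, over all ordered splits
`x = y ⊔ z`. -/
abbrev CauchyFib (V : Conf M → Type w) [∀ x, AddCommGroup (V x)] [∀ x, Module ℝ (V x)]
    (W : Conf M → Type w') [∀ x, AddCommGroup (W x)] [∀ x, Module ℝ (W x)] (x : Conf M) :
    Type (max u w w') :=
  ⨁ p : Split x, V p.fst ⊗[ℝ] W p.snd

/-- The split of `{x₁, …, x_k}` given by a set of indices. -/
def OConf.split {k : ℕ} {x : UConf k M} (f : OConf k M) (hf : f.toUConf = x)
    (I : Finset (Fin k)) : Split (⟨k, x⟩ : Conf M) :=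
  ⟨⟨I.card, f.sub I⟩, ⟨Iᶜ.card, f.sub Iᶜ⟩, by
    classical
    subst hf
    constructor
    · exact (Finset.disjoint_map _).2 disjoint_compl_right
    · simp only [Conf.pts, OConf.sub, OConf.toUConf]
      rw [← Finset.map_union, Finset.union_compl]⟩

theorem OConf.split_bijective {k : ℕ} {x : UConf k M} (f : OConf k M) (hf : f.toUConf = x) :
    Bijective (f.split hf) := by
  classical
  subst hf
  constructor
  · intro I J h
    have h1 : (f.split rfl I).fst.pts = (f.split rfl J).fst.pts := by rw [h]
    exact Finset.map_injective _ h1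
  · rintro ⟨y, z, h⟩
    obtain ⟨h1, h2⟩ := h
    have hI : (Finset.univ.filter fun i => f.1 i ∈ y.pts).map ⟨f.1, f.2⟩ = y.pts := by
      ext p
      simp only [Finset.mem_map, Finset.mem_filter, Finset.mem_univ, true_and,
        Function.Embedding.coeFn_mk]
      constructor
      · rintro ⟨i, hi, rfl⟩
        exact hi
      · intro hp
        have : p ∈ f.toUConf.1 := by
          change p ∈ Conf.pts (⟨k, f.toUConf⟩ : Conf M)
          rw [← h2]; exact Finset.mem_union_left _ hp
        obtain ⟨i, rfl⟩ := (f.mem_toUConf_iff p).1 this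
        exact ⟨i, hp, rfl⟩
    have hJ : (Finset.univ.filter fun i => f.1 i ∈ y.pts)ᶜ.map ⟨f.1, f.2⟩ = z.pts := by
      ext p
      simp only [Finset.mem_map, Finset.mem_compl, Finset.mem_filter, Finset.mem_univ, true_and,
        Function.Embedding.coeFn_mk]
      constructor
      · rintro ⟨i, hi, rfl⟩
        have : f.1 i ∈ Conf.pts (⟨k, f.toUConf⟩ : Conf M) := f.mem_toUConf i
        rw [← h2] at this
        exact (Finset.mem_union.1 this).resolve_left hi
      · intro hp
        have : p ∈ f.toUConf.1 := by
          change p ∈ Conf.pts (⟨k, f.toUConf⟩ : Conf M)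
          rw [← h2]; exact Finset.mem_union_right _ hp
        obtain ⟨i, rfl⟩ := (f.mem_toUConf_iff p).1 this
        exact ⟨i, fun hy => Finset.disjoint_left.1 h1 hy hp, rfl⟩
    refine ⟨Finset.univ.filter fun i => f.1 i ∈ y.pts, Split.ext ?_ ?_⟩
    · exact Conf.ext hI
    · exact Conf.ext hJ

theorem exists_basis_tmul {V W ι κ : Type*} [AddCommGroup V] [Module ℝ V] [AddCommGroup W]
    [Module ℝ W] {s : ι → V} {t : κ → W} (hs : ∃ b : Module.Basis ι ℝ V, ∀ a, b a = s a)
    (ht : ∃ b : Module.Basis κ ℝ W, ∀ a, b a = t a) :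
    ∃ b : Module.Basis (ι × κ) ℝ (V ⊗[ℝ] W), ∀ a, b a = s a.1 ⊗ₜ[ℝ] t a.2 := by
  obtain ⟨b, hb⟩ := hs
  obtain ⟨b', hb'⟩ := ht
  exact ⟨b.tensorProduct b', fun a => by rw [Module.Basis.tensorProduct_apply', hb, hb']⟩

/-- A family of bases gives a basis of the direct sum. -/
theorem exists_basis_directSum {κ J : Type*} [DecidableEq κ] (N : κ → Type*)
    [∀ i, AddCommGroup (N i)] [∀ i, Module ℝ (N i)] (π : J → κ) (hπ : Bijective π)
    (ι : J → Type*) (s : ∀ j, ι j → N (π j))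
    (hs : ∀ j, ∃ b : Module.Basis (ι j) ℝ (N (π j)), ∀ a, b a = s j a) :
    ∃ b : Module.Basis (Σ j, ι j) ℝ (⨁ i, N i),
      ∀ a, b a = DirectSum.lof ℝ κ N (π a.1) (s a.1 a.2) := by
  choose b hb using hs
  let e : κ ≃ J := (Equiv.ofBijective π hπ).symm
  classical
  let b' : Module.Basis (Σ j, ι j) ℝ (⨁ j, N (e.symm j)) := DFinsupp.basis b
  refine ⟨b'.map (DirectSum.lequivCongrLeft ℝ e).symm, fun a => ?_⟩
  have h : b' a = DirectSum.lof ℝ J (fun j => N (e.symm j)) a.1 (s a.1 a.2) := by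
    rw [← hb]
    apply b'.repr.injective
    rw [Module.Basis.repr_self]
    change _ = (sigmaFinsuppLequivDFinsupp ℝ).symm (DFinsupp.mapRange.linearEquiv
      (fun i => (b i).repr) (DFinsupp.single a.1 (b a.1 a.2)))
    rw [LinearEquiv.eq_symm_apply, DFinsupp.mapRange.linearEquiv_apply, DFinsupp.mapRange_single]
    refine (sigmaFinsuppEquivDFinsupp_single a (1 : ℝ)).trans ?_
    rw [Module.Basis.repr_self]
  rw [Module.Basis.map_apply, h]
  exact DirectSum.lequivCongrLeft_symm_lof ℝ

variable [TopologicalSpace M] [T2Space M]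
  {E : Type v} [NormedAddCommGroup E] [NormedSpace ℝ E] [ChartedSpace E M]

/-- Data for a local frame of `V ⊠ W` over `UConf k M`: a continuous ordering of configurations
and, for every set `I` of indices, local frames of `V` and `W` over the corresponding
subconfigurations. -/
structure CauchyFrameData (V : ConfBundle.{u, v, w} E M) (W : ConfBundle.{u, v, w'} E M)
    (k : ℕ) where
  L : LocalOrdering k M
  f : ∀ I : Finset (Fin k), LocalFrame (fun x : UConf I.card M => V.fib ⟨I.card, x⟩)
  f_mem : ∀ I, f I ∈ (V.str I.card).frames
  g : ∀ I : Finset (Fin k), LocalFrame (fun x : UConf Iᶜ.card M => W.fib ⟨Iᶜ.card, x⟩)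
  g_mem : ∀ I, g I ∈ (W.str Iᶜ.card).frames

variable [IsManifold 𝓘(ℝ, E) ∞ M]

/-- The local frame of `V ⊠ W` formed by the tensors `f_I ⊗ g_I`, in the summands given by the
sets `I` of indices. -/
def CauchyFrameData.toFrame {V : ConfBundle.{u, v, w} E M} {W : ConfBundle.{u, v, w'} E M}
    {k : ℕ} (D : CauchyFrameData V W k) :
    LocalFrame (fun x : UConf k M => CauchyFib V.fib W.fib ⟨k, x⟩) where
  ι := Σ I, (D.f I).ι × (D.g I).ι
  dom := {x | x ∈ D.L.dom ∧ ∀ I, (D.L.toFun x).sub I ∈ (D.f I).dom ∧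
    (D.L.toFun x).sub Iᶜ ∈ (D.g I).dom}
  isOpen_dom := by
    rw [isOpen_iff_mem_nhds]
    rintro x ⟨hx, hI⟩
    refine (D.L.isOpen_dom.eventually_mem hx).and (eventually_all.2 fun I => ?_)
    exact ((D.L.contMDiffAt_sub (E := E) hx I).continuousAt.eventually_mem
      ((D.f I).isOpen_dom.mem_nhds (hI I).1)).and
      ((D.L.contMDiffAt_sub (E := E) hx Iᶜ).continuousAt.eventually_mem
      ((D.g I).isOpen_dom.mem_nhds (hI I).2))
  sec a x := DirectSum.lof ℝ (Split (⟨k, x⟩ : Conf M)) (fun p => V.fib p.fst ⊗[ℝ] W.fib p.snd)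
    ((D.L.toFun x).split (D.L.toUConf_toFun x) a.1)
    ((D.f a.1).sec a.2.1 ((D.L.toFun x).sub a.1) ⊗ₜ[ℝ]
      (D.g a.1).sec a.2.2 ((D.L.toFun x).sub a.1ᶜ))
  exists_basis x hx := by
    refine exists_basis_directSum (fun p : Split (⟨k, x⟩ : Conf M) => V.fib p.fst ⊗[ℝ] W.fib p.snd)
      ((D.L.toFun x).split (D.L.toUConf_toFun x)) (OConf.split_bijective _ _)
      (fun I => (D.f I).ι × (D.g I).ι) (fun I a => (D.f I).sec a.1 ((D.L.toFun x).sub I) ⊗ₜ[ℝ]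
        (D.g I).sec a.2 ((D.L.toFun x).sub Iᶜ)) fun I => ?_
    exact exists_basis_tmul ((D.f I).exists_basis _ (hx.2 I).1)
      ((D.g I).exists_basis _ (hx.2 I).2)

theorem ConfBundle.exists_transition (V : ConfBundle.{u, v, w} E M) {E' : Type*}
    [NormedAddCommGroup E'] [NormedSpace ℝ E'] {X : Type*} [TopologicalSpace X] [ChartedSpace E' X]
    {i j : ℕ} {f : LocalFrame (fun x : UConf i M => V.fib ⟨i, x⟩)} (hf : f ∈ (V.str i).frames)
    {g : LocalFrame (fun x : UConf j M => V.fib ⟨j, x⟩)} (hg : g ∈ (V.str j).frames)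
    {s : X → UConf i M} {t : X → UConf j M} {x₀ : X}
    (hs : ContMDiffAt 𝓘(ℝ, E') 𝓘(ℝ, Fin i → E) ∞ s x₀)
    (hsf : s x₀ ∈ f.dom) (htg : t x₀ ∈ g.dom)
    (h : ∀ᶠ x in 𝓝 x₀, (⟨i, s x⟩ : Conf M) = ⟨j, t x⟩) :
    ∃ c : f.ι → g.ι → X → ℝ, (∀ a b, ContMDiffAt 𝓘(ℝ, E') 𝓘(ℝ, ℝ) ∞ (c a b) x₀) ∧
      ∀ᶠ x in 𝓝 x₀, ∀ a, f.sec a (s x) ≍ ∑ b, c a b x • g.sec b (t x) := by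
  have hij : i = j := congrArg Sigma.fst h.self_of_nhds
  subst hij
  have h' : ∀ᶠ x in 𝓝 x₀, s x = t x := h.mono fun x hx => eq_of_heq (Sigma.mk.inj hx).2
  rw [← h'.self_of_nhds] at htg
  obtain ⟨c, hc, hcs⟩ := (V.str i).compatible f hf g hg (s x₀) ⟨hsf, htg⟩
  refine ⟨fun a b x => c a b (s x), fun a b => (hc a b).comp x₀ hs, ?_⟩
  filter_upwards [hs.continuousAt.eventually hcs, h'] with x hx hx' a
  rw [← hx']
  exact heq_of_eq (hx a)

theorem lof_tmul_congr {V : Conf M → Type w} [∀ x, AddCommGroup (V x)] [∀ x, Module ℝ (V x)]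
    {W : Conf M → Type w'} [∀ x, AddCommGroup (W x)] [∀ x, Module ℝ (W x)] {x : Conf M}
    {p p' : Split x} (h : p = p') {v : V p.fst} {v' : V p'.fst} (hv : v ≍ v')
    {w : W p.snd} {w' : W p'.snd} (hw : w ≍ w') :
    DirectSum.lof ℝ (Split x) (fun p => V p.fst ⊗[ℝ] W p.snd) p (v ⊗ₜ[ℝ] w) =
      DirectSum.lof ℝ (Split x) (fun p => V p.fst ⊗[ℝ] W p.snd) p' (v' ⊗ₜ[ℝ] w') := by
  subst h
  rw [eq_of_heq hv, eq_of_heq hw]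

theorem lof_tmul_sum {V : Conf M → Type w} [∀ x, AddCommGroup (V x)] [∀ x, Module ℝ (V x)]
    {W : Conf M → Type w'} [∀ x, AddCommGroup (W x)] [∀ x, Module ℝ (W x)] {x : Conf M}
    (p : Split x) {ι κ : Type*} [Fintype ι] [Fintype κ] (c : ι → ℝ) (s : ι → V p.fst) (d : κ → ℝ)
    (t : κ → W p.snd) :
    DirectSum.lof ℝ (Split x) (fun p => V p.fst ⊗[ℝ] W p.snd) p
        ((∑ a, c a • s a) ⊗ₜ[ℝ] (∑ b, d b • t b)) =
      ∑ a, ∑ b, (c a * d b) •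
        DirectSum.lof ℝ (Split x) (fun p => V p.fst ⊗[ℝ] W p.snd) p (s a ⊗ₜ[ℝ] t b) := by
  rw [TensorProduct.sum_tmul, map_sum]
  refine Finset.sum_congr rfl fun a _ => ?_
  rw [TensorProduct.tmul_sum, map_sum]
  refine Finset.sum_congr rfl fun b _ => ?_
  rw [TensorProduct.smul_tmul_smul, map_smul]

theorem OConf.sub_perm {k : ℕ} (f : OConf k M) (σ : Equiv.Perm (Fin k)) (I : Finset (Fin k)) :
    (⟨I.card, f.sub I⟩ : Conf M) =
      ⟨(I.map σ.symm.toEmbedding).card, (f.perm σ).sub (I.map σ.symm.toEmbedding)⟩ := by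
  apply Conf.ext
  simp only [Conf.pts, OConf.sub, Finset.map_map]
  congr 1
  ext i
  change f.1 i = f.1 (σ (σ.symm i))
  simp

theorem CauchyFrameData.compatible {V : ConfBundle.{u, v, w} E M}
    {W : ConfBundle.{u, v, w'} E M} {k : ℕ} (D D' : CauchyFrameData V W k) :
    IsSmoothIn (Fin k → E) (fun _ => LinearMap.id) D.toFrame D'.toFrame := by
  classical
  rintro x₀ ⟨⟨hx, hI⟩, ⟨hx', hI'⟩⟩
  have hc := D.L.continuousOn.continuousAt (D.L.isOpen_dom.mem_nhds hx)
  have hc' := D'.L.continuousOn.continuousAt (D'.L.isOpen_dom.mem_nhds hx')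
  have hq : ∀ x, (D.L.toFun x).toUConf = (D'.L.toFun x).toUConf := fun x => by
    rw [D.L.toUConf_toFun, D'.L.toUConf_toFun]
  obtain ⟨σ, hσ⟩ := OConf.exists_perm (hq x₀)
  have hev : ∀ᶠ x in 𝓝 x₀, D'.L.toFun x = (D.L.toFun x).perm σ :=
    OConf.eventually_eq_perm hc (by rw [← hσ]; exact hc') (.of_forall hq)
  let T : Finset (Fin k) → Finset (Fin k) := fun I => I.map σ.symm.toEmbedding
  have hT : ∀ I, (T I)ᶜ = T Iᶜ := fun I => by
    ext i
    simp [T, Finset.mem_map_equiv]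
  have h1 : ∀ I J, ∃ c : (D.f I).ι → (D'.f J).ι → UConf k M → ℝ,
      (∀ a b, ContMDiffAt 𝓘(ℝ, Fin k → E) 𝓘(ℝ, ℝ) ∞ (c a b) x₀) ∧
      (J = T I → ∀ᶠ x in 𝓝 x₀, ∀ a, (D.f I).sec a ((D.L.toFun x).sub I) ≍
        ∑ b, c a b x • (D'.f J).sec b ((D'.L.toFun x).sub J)) := by
    intro I J
    by_cases h : J = T I
    · subst h
      obtain ⟨c, hc1, hc2⟩ := V.exists_transition (D.f_mem I) (D'.f_mem (T I))
        (D.L.contMDiffAt_sub hx I) (t := fun x => (D'.L.toFun x).sub (T I)) (hI I).1 (hI' (T I)).1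
        (hev.mono fun x hx => by rw [hx]; exact OConf.sub_perm _ _ _)
      exact ⟨c, hc1, fun _ => hc2⟩
    · exact ⟨fun _ _ _ => 0, fun _ _ => contMDiffAt_const, fun h' => absurd h' h⟩
  have h2 : ∀ I J, ∃ c : (D.g I).ι → (D'.g J).ι → UConf k M → ℝ,
      (∀ a b, ContMDiffAt 𝓘(ℝ, Fin k → E) 𝓘(ℝ, ℝ) ∞ (c a b) x₀) ∧
      (J = T I → ∀ᶠ x in 𝓝 x₀, ∀ a, (D.g I).sec a ((D.L.toFun x).sub Iᶜ) ≍
        ∑ b, c a b x • (D'.g J).sec b ((D'.L.toFun x).sub Jᶜ)) := by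
    intro I J
    by_cases h : J = T I
    · subst h
      obtain ⟨c, hc1, hc2⟩ := W.exists_transition (D.g_mem I) (D'.g_mem (T I))
        (D.L.contMDiffAt_sub hx Iᶜ) (t := fun x => (D'.L.toFun x).sub (T I)ᶜ)
        (hI I).2 (hI' (T I)).2
        (hev.mono fun x hx => by rw [hx, hT]; exact OConf.sub_perm _ _ _)
      exact ⟨c, hc1, fun _ => hc2⟩
    · exact ⟨fun _ _ _ => 0, fun _ _ => contMDiffAt_const, fun h' => absurd h' h⟩
  choose c hc1 hc2 using h1
  choose d hd1 hd2 using h2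
  refine ⟨fun a b x => if b.1 = T a.1 then c a.1 b.1 a.2.1 b.2.1 x * d a.1 b.1 a.2.2 b.2.2 x else 0,
    fun a b => ?_, ?_⟩
  · by_cases h : b.1 = T a.1
    all_goals simp only [h, if_true, if_false]
    · exact (hc1 _ _ _ _).mul (hd1 _ _ _ _)
    · exact contMDiffAt_const
  · filter_upwards [hev, eventually_all.2 fun I => hc2 I (T I) rfl,
      eventually_all.2 fun I => hd2 I (T I) rfl] with x hx hcx hdx
    rintro ⟨I, a, b⟩
    have hsplit : (D.L.toFun x).split (D.L.toUConf_toFun x) I =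
        (D'.L.toFun x).split (D'.L.toUConf_toFun x) (T I) := by
      refine Split.ext ?_ ?_
      · change (⟨_, (D.L.toFun x).sub I⟩ : Conf M) = ⟨_, (D'.L.toFun x).sub (T I)⟩
        rw [hx]
        exact OConf.sub_perm _ _ _
      · change (⟨_, (D.L.toFun x).sub Iᶜ⟩ : Conf M) = ⟨_, (D'.L.toFun x).sub (T I)ᶜ⟩
        rw [hx, hT]
        exact OConf.sub_perm _ _ _
    change DirectSum.lof ℝ (Split (⟨k, x⟩ : Conf M)) (fun p => V.fib p.fst ⊗[ℝ] W.fib p.snd)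
      ((D.L.toFun x).split (D.L.toUConf_toFun x) I) ((D.f I).sec a ((D.L.toFun x).sub I) ⊗ₜ[ℝ]
      (D.g I).sec b ((D.L.toFun x).sub Iᶜ)) = _
    rw [lof_tmul_congr hsplit (hcx I a) (hdx I b)]
    refine Eq.trans ?_ (Fintype.sum_sigma (α := fun J => (D'.f J).ι × (D'.g J).ι) _).symm
    rw [Finset.sum_eq_single (T I)]
    · simp only [if_true]
      rw [Fintype.sum_prod_type]
      exact lof_tmul_sum (V := V.fib) (W := W.fib)
        ((D'.L.toFun x).split (D'.L.toUConf_toFun x) (T I)) _ _ _ _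
    · intro J _ hJ
      refine Finset.sum_eq_zero fun b _ => ?_
      rw [if_neg hJ, zero_smul]
    · intro h
      exact absurd (Finset.mem_univ _) h

/-- The Cauchy tensor product of two vector bundles over `UConf(M)`. -/
def ConfBundle.cauchy (V : ConfBundle.{u, v, w} E M) (W : ConfBundle.{u, v, w'} E M) :
    ConfBundle.{u, v, max u w w'} E M where
  fib := CauchyFib V.fib W.fib
  str k :=
    { frames := range fun D : CauchyFrameData V W k => D.toFrame
      covers := by
        intro x
        obtain ⟨L, hL⟩ := LocalOrdering.exists_mem_dom x
        choose f hf hfx using fun I => (V.str _).covers ((L.toFun x).sub I)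
        choose g hg hgx using fun I : Finset (Fin k) => (W.str _).covers ((L.toFun x).sub Iᶜ)
        exact ⟨_, mem_range_self ⟨L, f, hf, g, hg⟩, hL, fun I => ⟨hfx I, hgx I⟩⟩
      compatible := by
        rintro _ ⟨D, rfl⟩ _ ⟨D', rfl⟩
        exact D.compatible D' }

end Cauchy

/-! ### Cauchy algebra bundles -/

section Algebra

variable {M : Type u} [TopologicalSpace M] [T2Space M]
  {E : Type v} [NormedAddCommGroup E] [NormedSpace ℝ E] [ChartedSpace E M]
  [IsManifold 𝓘(ℝ, E) ∞ M]

/-- The component `A_y ⊗ A_z → A_x` of a bundle map `m : A ⊠ A → A` at a split `x = y ⊔ z`,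
applied to `a ⊗ b`. -/
def ConfBundle.Hom.mul {A : ConfBundle.{u, v, w} E M} (m : ConfBundle.Hom (A.cauchy A) A)
    {x y z : Conf M} (h : IsSplit x y z) (a : A.fib y) (b : A.fib z) : A.fib x :=
  m.toFun x (DirectSum.lof ℝ (Split x) (fun p => A.fib p.fst ⊗[ℝ] A.fib p.snd) ⟨y, z, h⟩
    (a ⊗ₜ[ℝ] b))

/-- The structure of a commutative `⊠`-algebra bundle on `A`: a smooth bundle map `m : A ⊠ A → A`,
and a bundle map from the unit bundle of `⊠` (which is `ℝ` over the empty configuration and zero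
elsewhere) to `A`, that is, a vector of `A_∅`, subject to associativity, unitality and
commutativity. -/
structure CommCauchyAlgebra (A : ConfBundle.{u, v, w} E M) where
  m : ConfBundle.Hom (A.cauchy A) A
  one : A.fib Conf.empty
  assoc : ∀ {x y z t s r : Conf M} (hyz : IsSplit t y z) (htr : IsSplit x t r)
    (hzr : IsSplit s z r) (hys : IsSplit x y s) (a : A.fib y) (b : A.fib z) (c : A.fib r),
    m.mul htr (m.mul hyz a b) c = m.mul hys a (m.mul hzr b c)
  mul_one : ∀ {x : Conf M} (h : IsSplit x x Conf.empty) (a : A.fib x), m.mul h a one = a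
  one_mul : ∀ {x : Conf M} (h : IsSplit x Conf.empty x) (a : A.fib x), m.mul h one a = a
  comm : ∀ {x y z : Conf M} (h : IsSplit x y z) (a : A.fib y) (b : A.fib z),
    m.mul h a b = m.mul h.symm b a

end Algebra

/-! ### The Cauchy symmetric bundle -/

section Symmetric

variable {M : Type u}

instance (x : Conf M) : DecidableEq (Fin x.1 ≃ x.pts) := Classical.decEq _

/-- The disjoint union of the points of the parts of a split. -/
def IsSplit.ptsEquiv {x y z : Conf M} (h : IsSplit x y z) : y.pts ⊕ z.pts ≃ x.pts :=
  Equiv.ofBijective (fun s => ⟨Sum.elim (fun p => p.1) (fun p => p.1) s, by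
      classical
      rw [← h.2]
      rcases s with p | p
      · exact Finset.mem_union_left _ p.2
      · exact Finset.mem_union_right _ p.2⟩) (by
    classical
    constructor
    · rintro (p | p) (q | q) hpq
      · have hpq' : p.1 = q.1 := Subtype.mk.inj hpq
        exact congrArg Sum.inl (Subtype.ext hpq')
      · have hpq' : p.1 = q.1 := congrArg Subtype.val hpq
        exact absurd (hpq' ▸ q.2) (Finset.disjoint_left.1 h.1 p.2)
      · have hpq' : p.1 = q.1 := congrArg Subtype.val hpq
        exact absurd (hpq' ▸ p.2) (Finset.disjoint_left.1 h.1 q.2)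
      · have hpq' : p.1 = q.1 := Subtype.mk.inj hpq
        exact congrArg Sum.inr (Subtype.ext hpq')
    · rintro ⟨p, hp⟩
      rw [← h.2] at hp
      rcases Finset.mem_union.1 hp with hp | hp
      · exact ⟨Sum.inl ⟨p, hp⟩, rfl⟩
      · exact ⟨Sum.inr ⟨p, hp⟩, rfl⟩)

theorem IsSplit.card_eq {x y z : Conf M} (h : IsSplit x y z) : x.1 = y.1 + z.1 := by
  classical
  have := Finset.card_union_of_disjoint h.1
  rw [h.2] at this
  rw [← x.2.2, ← y.2.2, ← z.2.2]
  exact this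

/-- The bijection `{1, …, i + j} ≃ {1, …, i} ⊔ {1, …, j}` by concatenation. -/
def IsSplit.index {x y z : Conf M} (h : IsSplit x y z) : Fin x.1 ≃ Fin y.1 ⊕ Fin z.1 :=
  (finCongr h.card_eq).trans finSumFinEquiv.symm

/-- The concatenation of an ordering of `y` and an ordering of `z`, for `x = y ⊔ z`. -/
def IsSplit.concat {x y z : Conf M} (h : IsSplit x y z) (e : Fin y.1 ≃ y.pts)
    (e' : Fin z.1 ≃ z.pts) : Fin x.1 ≃ x.pts :=
  h.index.trans ((Equiv.sumCongr e e').trans h.ptsEquiv)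

variable (V : M → Type w) [∀ p, AddCommGroup (V p)] [∀ p, Module ℝ (V p)]

/-- The fibre `⨁_e V_{e(1)} ⊗ ⋯ ⊗ V_{e(k)}` of the Cauchy tensor bundle over a configuration of
`k` points, the sum being over all orderings `e` of the configuration. -/
abbrev TensorFib (x : Conf M) : Type (max u w) :=
  ⨁ e : Fin x.1 ≃ x.pts, ⨂[ℝ] i : Fin x.1, V (e i)

/-- The element `v₁ ⊗ ⋯ ⊗ v_k` of the summand given by the ordering `e`. -/
def TensorFib.of {x : Conf M} (e : Fin x.1 ≃ x.pts) (v : ∀ i, V (e i)) : TensorFib V x :=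
  DirectSum.lof ℝ (Fin x.1 ≃ x.pts) (fun e => ⨂[ℝ] i : Fin x.1, V (e i)) e
    (PiTensorProduct.tprod ℝ v)

/-- The span of the differences
`v₁ ⊗ ⋯ ⊗ v_k - v_{σ(1)} ⊗ ⋯ ⊗ v_{σ(k)}`. -/
def symRel (x : Conf M) : Submodule ℝ (TensorFib V x) :=
  Submodule.span ℝ {t | ∃ (e : Fin x.1 ≃ x.pts) (σ : Equiv.Perm (Fin x.1)) (v : ∀ i, V (e i)),
    t = TensorFib.of V e v - TensorFib.of V (σ.trans e) fun i => v (σ i)}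

/-- The fibre of the Cauchy symmetric bundle: the quotient of the fibre of the Cauchy tensor
bundle by the action of the symmetric group. -/
abbrev SymFib (x : Conf M) : Type (max u w) := TensorFib V x ⧸ symRel V x

variable {V}

/-- The class of `v₁ ⊗ ⋯ ⊗ v_k`. -/
def SymFib.of {x : Conf M} (e : Fin x.1 ≃ x.pts) (v : ∀ i, V (e i)) : SymFib V x :=
  (symRel V x).mkQ (TensorFib.of V e v)

theorem SymFib.of_perm {x : Conf M} (e : Fin x.1 ≃ x.pts) (σ : Equiv.Perm (Fin x.1))
    (v : ∀ i, V (e i)) : SymFib.of e v = SymFib.of (σ.trans e) fun i => v (σ i) := by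
  change (symRel V x).mkQ _ = (symRel V x).mkQ _
  rw [← sub_eq_zero, ← map_sub]
  exact (Submodule.Quotient.mk_eq_zero _).2 (Submodule.subset_span ⟨e, σ, v, rfl⟩)

theorem SymFib.of_congr {x : Conf M} (e e' : Fin x.1 ≃ x.pts) (u : ∀ p : x.pts, V p) :
    SymFib.of e (fun i => u (e i)) = SymFib.of e' fun i => u (e' i) := by
  obtain ⟨σ, rfl⟩ : ∃ σ : Equiv.Perm (Fin x.1), e' = σ.trans e :=
    ⟨e'.trans e.symm, by ext i; simp⟩
  exact SymFib.of_perm e σ _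

theorem TensorFib.exists_eq_comp {x : Conf M} (e : Fin x.1 ≃ x.pts) (v : ∀ i, V (e i)) :
    ∃ u : ∀ p : x.pts, V p, v = fun i => u (e i) :=
  ⟨Equiv.piCongrLeft (fun p : x.pts => V p) e v, funext fun i =>
    (Equiv.piCongrLeft_apply_apply (fun p : x.pts => V p) e v i).symm⟩

theorem TensorFib.hom_ext {x : Conf M} {N : Type*} [AddCommGroup N] [Module ℝ N]
    {φ ψ : TensorFib V x →ₗ[ℝ] N}
    (h : ∀ (e : Fin x.1 ≃ x.pts) (u : ∀ p : x.pts, V p),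
      φ (TensorFib.of V e fun i => u (e i)) = ψ (TensorFib.of V e fun i => u (e i))) : φ = ψ := by
  refine DirectSum.linearMap_ext ℝ fun e => PiTensorProduct.ext (MultilinearMap.ext fun v => ?_)
  obtain ⟨u, rfl⟩ := TensorFib.exists_eq_comp e v
  exact h e u

variable (V)

/-- The concatenation product
`(v₁ ⊗ ⋯ ⊗ v_i, w₁ ⊗ ⋯ ⊗ w_j) ↦ v₁ ⊗ ⋯ ⊗ v_i ⊗ w₁ ⊗ ⋯ ⊗ w_j`. -/
def tensorMul {x y z : Conf M} (h : IsSplit x y z) :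
    TensorFib V y →ₗ[ℝ] TensorFib V z →ₗ[ℝ] TensorFib V x :=
  DirectSum.toModule ℝ _ _ fun e => LinearMap.flip <| DirectSum.toModule ℝ _ _ fun e' =>
    LinearMap.flip <| (TensorProduct.mk ℝ (⨂[ℝ] i : Fin y.1, V (e i))
      (⨂[ℝ] j : Fin z.1, V (e' j))).compr₂ <|
      (DirectSum.lof ℝ (Fin x.1 ≃ x.pts) (fun e => ⨂[ℝ] i : Fin x.1, V (e i)) (h.concat e e')) ∘ₗ
        (PiTensorProduct.reindex ℝ (fun s : Fin y.1 ⊕ Fin z.1 => V (h.ptsEquiv (Sum.map e e' s)))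
          h.index.symm).toLinearMap ∘ₗ
        (PiTensorProduct.tmulEquivDep ℝ
          (fun s : Fin y.1 ⊕ Fin z.1 => V (h.ptsEquiv (Sum.map e e' s)))).toLinearMap

theorem tensorMul_of {x y z : Conf M} (h : IsSplit x y z) (e : Fin y.1 ≃ y.pts)
    (e' : Fin z.1 ≃ z.pts) (u : ∀ p : x.pts, V p) :
    tensorMul V h (TensorFib.of V e fun i => u (h.ptsEquiv (Sum.inl (e i))))
      (TensorFib.of V e' fun j => u (h.ptsEquiv (Sum.inr (e' j)))) =
    TensorFib.of V (h.concat e e') fun i => u (h.concat e e' i) := by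
  simp only [tensorMul, TensorFib.of, DirectSum.toModule_lof, LinearMap.flip_apply,
    LinearMap.compr₂_apply, LinearMap.comp_apply, TensorProduct.mk_apply]
  refine congrArg _ ?_
  refine (congrArg (PiTensorProduct.reindex ℝ
    (fun s : Fin y.1 ⊕ Fin z.1 => V (h.ptsEquiv (Sum.map e e' s))) h.index.symm)
    (PiTensorProduct.tmulEquivDep_apply (R := ℝ)
      (N := fun s : Fin y.1 ⊕ Fin z.1 => V (h.ptsEquiv (Sum.map e e' s))) _ _)).trans ?_
  refine (PiTensorProduct.reindex_tprod _ _).trans ?_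
  refine congrArg (PiTensorProduct.tprod ℝ (s := fun i => V (h.concat e e' i))) (funext fun i => ?_)
  change _ = u (h.ptsEquiv (Sum.map e e' (h.index i)))
  simp only [Equiv.symm_symm]
  rcases h.index i with j | j <;> rfl

theorem tensorMul_rel {x y z : Conf M} (h : IsSplit x y z) (e e₁ : Fin y.1 ≃ y.pts)
    (e' e₁' : Fin z.1 ≃ z.pts) (u : ∀ p : y.pts, V p) (u' : ∀ p : z.pts, V p) :
    (symRel V x).mkQ (tensorMul V h (TensorFib.of V e fun i => u (e i))
      (TensorFib.of V e' fun j => u' (e' j))) =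
    (symRel V x).mkQ (tensorMul V h (TensorFib.of V e₁ fun i => u (e₁ i))
      (TensorFib.of V e₁' fun j => u' (e₁' j))) := by
  obtain ⟨U, hU, hU'⟩ : ∃ U : ∀ p : x.pts, V p, (∀ p, U (h.ptsEquiv (Sum.inl p)) = u p) ∧
      ∀ p, U (h.ptsEquiv (Sum.inr p)) = u' p := by
    let W : ∀ s : y.pts ⊕ z.pts, V (h.ptsEquiv s) := fun s => match s with
      | Sum.inl p => u p
      | Sum.inr p => u' p
    exact ⟨Equiv.piCongrLeft (fun p : x.pts => V p) h.ptsEquiv W,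
      fun p => Equiv.piCongrLeft_apply_apply (fun p : x.pts => V p) h.ptsEquiv W (Sum.inl p),
      fun p => Equiv.piCongrLeft_apply_apply (fun p : x.pts => V p) h.ptsEquiv W (Sum.inr p)⟩
  obtain rfl : u = fun p => U (h.ptsEquiv (Sum.inl p)) := funext fun p => (hU p).symm
  obtain rfl : u' = fun p => U (h.ptsEquiv (Sum.inr p)) := funext fun p => (hU' p).symm
  erw [tensorMul_of, tensorMul_of]
  exact SymFib.of_congr _ _ U

/-- The product `⊡` of the Cauchy symmetric bundle, induced by concatenation. -/
def symMul {x y z : Conf M} (h : IsSplit x y z) :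
    SymFib V y →ₗ[ℝ] SymFib V z →ₗ[ℝ] SymFib V x :=
  LinearMap.flip <| (symRel V z).liftQ
    (LinearMap.flip <| (symRel V y).liftQ ((tensorMul V h).compr₂ (symRel V x).mkQ) (by
      refine Submodule.span_le.2 ?_
      rintro _ ⟨e, σ, v, rfl⟩
      obtain ⟨u, rfl⟩ := TensorFib.exists_eq_comp e v
      change _ = _
      rw [map_sub, sub_eq_zero]
      refine TensorFib.hom_ext fun e' u' => ?_
      exact tensorMul_rel V h e (σ.trans e) e' e' u u')) (by
      refine Submodule.span_le.2 ?_
      rintro _ ⟨e', σ, v, rfl⟩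
      obtain ⟨u', rfl⟩ := TensorFib.exists_eq_comp e' v
      change _ = _
      rw [map_sub, sub_eq_zero]
      refine Submodule.linearMap_qext _ (TensorFib.hom_ext fun e u => ?_)
      exact tensorMul_rel V h e e e' (σ.trans e') u u')

/-- The unit of the Cauchy symmetric bundle: the empty tensor over the empty configuration. -/
def symOne : SymFib V Conf.empty :=
  SymFib.of (x := Conf.empty)
    (haveI : IsEmpty (Conf.empty : Conf M).pts := inferInstanceAs (IsEmpty (∅ : Finset M))
     Equiv.equivOfIsEmpty (Fin 0) _) (fun i => Fin.elim0 i)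

end Symmetric

section SymmetricBundle

variable {M : Type u}

section Fibre

variable {V : M → Type w} [∀ p, AddCommGroup (V p)] [∀ p, Module ℝ (V p)]

theorem reindex_symm_tprod' {x : Conf M} (e : Fin x.1 ≃ x.pts) (u : ∀ p : x.pts, V p) :
    (PiTensorProduct.reindex ℝ (fun p : x.pts => V p) e.symm).symm
      (PiTensorProduct.tprod ℝ fun i => u (e i) : ⨂[ℝ] i, V (e i)) =
      PiTensorProduct.tprod ℝ (s := fun p : x.pts => V p) u := by
  rw [LinearEquiv.symm_apply_eq]
  exact (PiTensorProduct.reindex_tprod (R := ℝ) (s := fun p : x.pts => V p) e.symm u).symm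

theorem reindex_tprod' {x : Conf M} (e : Fin x.1 ≃ x.pts) (u : ∀ p : x.pts, V p) :
    PiTensorProduct.reindex ℝ (fun p : x.pts => V p) e.symm (PiTensorProduct.tprod ℝ u) =
      (PiTensorProduct.tprod ℝ fun i => u (e i) : ⨂[ℝ] i, V (e i)) :=
  PiTensorProduct.reindex_tprod (s := fun p : x.pts => V p) e.symm u

/-- The map from the fibre of the Cauchy symmetric bundle to the unordered tensor product. -/
def SymFib.toPts (V : M → Type w) [∀ p, AddCommGroup (V p)] [∀ p, Module ℝ (V p)] (x : Conf M) :
    SymFib V x →ₗ[ℝ] ⨂[ℝ] p : x.pts, V p :=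
  (symRel V x).liftQ (DirectSum.toModule ℝ _ _ fun e =>
    (PiTensorProduct.reindex ℝ (fun p : x.pts => V p) e.symm).symm.toLinearMap) (by
    refine Submodule.span_le.2 ?_
    rintro _ ⟨e', σ, v, rfl⟩
    obtain ⟨u, rfl⟩ := TensorFib.exists_eq_comp e' v
    change _ = _
    rw [map_sub, sub_eq_zero]
    simp only [TensorFib.of, DirectSum.toModule_lof]
    exact (reindex_symm_tprod' e' u).trans (reindex_symm_tprod' (σ.trans e') u).symm)

theorem SymFib.toPts_of {x : Conf M} (e : Fin x.1 ≃ x.pts) (u : ∀ p : x.pts, V p) :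
    SymFib.toPts V x (SymFib.of e fun i => u (e i)) = PiTensorProduct.tprod ℝ u := by
  change DirectSum.toModule ℝ _ _ _ (TensorFib.of V e fun i => u (e i)) = _
  rw [TensorFib.of, DirectSum.toModule_lof]
  exact reindex_symm_tprod' e u

/-- Any ordering `e` identifies the fibre of the Cauchy symmetric bundle with
`V_{e(1)} ⊗ ⋯ ⊗ V_{e(k)}`. -/
def SymFib.equiv (V : M → Type w) [∀ p, AddCommGroup (V p)] [∀ p, Module ℝ (V p)] {x : Conf M}
    (e : Fin x.1 ≃ x.pts) : (⨂[ℝ] i, V (e i)) ≃ₗ[ℝ] SymFib V x :=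
  LinearEquiv.ofLinear
    ((symRel V x).mkQ ∘ₗ DirectSum.lof ℝ (Fin x.1 ≃ x.pts) (fun e => ⨂[ℝ] i : Fin x.1, V (e i)) e)
    ((PiTensorProduct.reindex ℝ (fun p : x.pts => V p) e.symm).toLinearMap ∘ₗ SymFib.toPts V x)
    (by
      refine Submodule.linearMap_qext _ (TensorFib.hom_ext fun e' u => ?_)
      change (symRel V x).mkQ (DirectSum.lof ℝ (Fin x.1 ≃ x.pts)
        (fun e => ⨂[ℝ] i : Fin x.1, V (e i)) e
        (PiTensorProduct.reindex ℝ (fun p : x.pts => V p) e.symm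
          (SymFib.toPts V x (SymFib.of e' fun i => u (e' i))))) = SymFib.of e' fun i => u (e' i)
      rw [SymFib.toPts_of]
      refine (congrArg (fun t => (symRel V x).mkQ (DirectSum.lof ℝ (Fin x.1 ≃ x.pts)
        (fun e => ⨂[ℝ] i : Fin x.1, V (e i)) e t)) (reindex_tprod' e u)).trans ?_
      exact SymFib.of_congr e e' u)
    (by
      refine PiTensorProduct.ext (MultilinearMap.ext fun v => ?_)
      obtain ⟨u, rfl⟩ := TensorFib.exists_eq_comp e v
      exact (congrArg (PiTensorProduct.reindex ℝ (fun p : x.pts => V p) e.symm)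
        (SymFib.toPts_of e u)).trans (reindex_tprod' e u))

theorem SymFib.exists_basis {x : Conf M} (e : Fin x.1 ≃ x.pts) (ι : Fin x.1 → Type*)
    [∀ i, Fintype (ι i)] (s : ∀ i, ι i → V (e i))
    (hs : ∀ i, ∃ b : Module.Basis (ι i) ℝ (V (e i)), ∀ a, b a = s i a) :
    ∃ b : Module.Basis (∀ i, ι i) ℝ (SymFib V x),
      ∀ a, b a = SymFib.of e fun i => s i (a i) := by
  choose b hb using hs
  refine ⟨(Basis.piTensorProduct b).map (SymFib.equiv V e), fun a => ?_⟩
  rw [Module.Basis.map_apply, Basis.piTensorProduct_apply]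
  simp only [hb]
  rfl

theorem SymFib.of_sum {x : Conf M} (e : Fin x.1 ≃ x.pts) (ι : Fin x.1 → Type*)
    [∀ i, Fintype (ι i)] (c : ∀ i, ι i → ℝ) (s : ∀ i, ι i → V (e i)) :
    SymFib.of e (fun i => ∑ b, c i b • s i b) =
      ∑ b : ∀ i, ι i, (∏ i, c i (b i)) • SymFib.of e fun i => s i (b i) := by
  classical
  change SymFib.equiv V e (PiTensorProduct.tprod ℝ _) = _
  rw [MultilinearMap.map_sum, map_sum]
  refine Finset.sum_congr rfl fun b _ => ?_
  rw [MultilinearMap.map_smul_univ, map_smul]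
  rfl

end Fibre

/-- The ordering of the points of a configuration given by a preimage in `OConf k M`. -/
def OConf.ordering {k : ℕ} {x : UConf k M} (f : OConf k M) (hf : f.toUConf = x) :
    Fin k ≃ Conf.pts (⟨k, x⟩ : Conf M) :=
  Equiv.ofBijective (fun i => ⟨f.1 i, hf ▸ f.mem_toUConf i⟩) (by
    subst hf
    constructor
    · intro i j hij
      exact f.2 (Subtype.mk.inj hij)
    · rintro ⟨p, hp⟩
      obtain ⟨i, rfl⟩ := (f.mem_toUConf_iff p).1 hp
      exact ⟨i, rfl⟩)

variable [TopologicalSpace M] [T2Space M]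
  {E : Type v} [NormedAddCommGroup E] [NormedSpace ℝ E] [ChartedSpace E M]

/-- Data for a local frame of `S^⊠(V)` over `UConf k M`: a continuous ordering of configurations
and local frames of `V` around each of the ordered points. -/
structure SymFrameData (V : SmoothBundle.{u, v, w} E M) (k : ℕ) where
  L : LocalOrdering k M
  f : Fin k → LocalFrame V.fib
  f_mem : ∀ i, f i ∈ V.str.frames

variable [IsManifold 𝓘(ℝ, E) ∞ M]

/-- The local frame of `S^⊠(V)` formed by the classes of the tensors `f₁ ⊗ ⋯ ⊗ f_k`. -/
def SymFrameData.toFrame {V : SmoothBundle.{u, v, w} E M} {k : ℕ} (D : SymFrameData V k) :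
    LocalFrame (fun x : UConf k M => SymFib V.fib ⟨k, x⟩) where
  ι := ∀ i, (D.f i).ι
  dom := {x | x ∈ D.L.dom ∧ ∀ i, (D.L.toFun x).1 i ∈ (D.f i).dom}
  isOpen_dom := by
    rw [isOpen_iff_mem_nhds]
    rintro x ⟨hx, hi⟩
    refine (D.L.isOpen_dom.eventually_mem hx).and (eventually_all.2 fun i => ?_)
    exact (D.L.contMDiffAt_apply (E := E) hx i).continuousAt.eventually_mem
      ((D.f i).isOpen_dom.mem_nhds (hi i))
  sec a x := SymFib.of (x := (⟨k, x⟩ : Conf M)) ((D.L.toFun x).ordering (D.L.toUConf_toFun x))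
    fun i => (D.f i).sec (a i) ((D.L.toFun x).1 i)
  exists_basis x hx :=
    SymFib.exists_basis (x := (⟨k, x⟩ : Conf M)) ((D.L.toFun x).ordering (D.L.toUConf_toFun x))
      (fun i => (D.f i).ι) (fun i a => (D.f i).sec a ((D.L.toFun x).1 i))
      fun i => (D.f i).exists_basis _ (hx.2 i)

theorem OConf.of_perm {V : M → Type w} [∀ p, AddCommGroup (V p)] [∀ p, Module ℝ (V p)]
    {k : ℕ} {x : UConf k M} {f g : OConf k M} (hf : f.toUConf = x) (hg : g.toUConf = x)
    {σ : Equiv.Perm (Fin k)} (h : g = f.perm σ) (s : Fin k → ∀ p, V p) :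
    SymFib.of (x := (⟨k, x⟩ : Conf M)) (f.ordering hf) (fun i => s i (f.1 i)) =
      SymFib.of (x := (⟨k, x⟩ : Conf M)) (g.ordering hg) fun j => s (σ j) (g.1 j) := by
  subst h
  refine (SymFib.of_perm (x := (⟨k, x⟩ : Conf M)) (f.ordering hf) σ _).trans ?_
  have he : σ.trans (f.ordering hf) = (f.perm σ).ordering hg := by
    ext i
    rfl
  exact congrArg (fun e : Fin k ≃ Conf.pts (⟨k, x⟩ : Conf M) =>
    SymFib.of (x := (⟨k, x⟩ : Conf M)) e fun i => s (σ i) (e i)) he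

theorem SymFrameData.compatible {V : SmoothBundle.{u, v, w} E M} {k : ℕ}
    (D D' : SymFrameData V k) :
    IsSmoothIn (Fin k → E) (fun _ => LinearMap.id) D.toFrame D'.toFrame := by
  classical
  rintro x₀ ⟨⟨hx, hi⟩, ⟨hx', hi'⟩⟩
  have hc := D.L.continuousOn.continuousAt (D.L.isOpen_dom.mem_nhds hx)
  have hc' := D'.L.continuousOn.continuousAt (D'.L.isOpen_dom.mem_nhds hx')
  have hq : ∀ x, (D.L.toFun x).toUConf = (D'.L.toFun x).toUConf := fun x => by
    rw [D.L.toUConf_toFun, D'.L.toUConf_toFun]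
  obtain ⟨σ, hσ⟩ := OConf.exists_perm (hq x₀)
  have hev : ∀ᶠ x in 𝓝 x₀, D'.L.toFun x = (D.L.toFun x).perm σ :=
    OConf.eventually_eq_perm hc (by rw [← hσ]; exact hc') (.of_forall hq)
  have h1 : ∀ j, ∃ c : (D.f (σ j)).ι → (D'.f j).ι → M → ℝ,
      (∀ a b, ContMDiffAt 𝓘(ℝ, E) 𝓘(ℝ, ℝ) ∞ (c a b) ((D'.L.toFun x₀).1 j)) ∧
      ∀ᶠ y in 𝓝 ((D'.L.toFun x₀).1 j), ∀ a, (D.f (σ j)).sec a y =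
        ∑ b, c a b y • (D'.f j).sec b y := fun j =>
    V.str.compatible _ (D.f_mem (σ j)) _ (D'.f_mem j) _
      ⟨by rw [hσ]; exact hi (σ j), hi' j⟩
  choose c hc1 hc2 using h1
  refine ⟨fun a b x => ∏ j, c j (a (σ j)) (b j) ((D'.L.toFun x).1 j), fun a b => ?_, ?_⟩
  · exact contMDiffAt_finset_prod fun j _ =>
      (hc1 j _ _).comp x₀ (D'.L.contMDiffAt_apply hx' j)
  · filter_upwards [hev, eventually_all.2 fun j =>
      (D'.L.contMDiffAt_apply (E := E) hx' j).continuousAt.eventually (hc2 j)] with x hx hcx a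
    refine (OConf.of_perm (V := V.fib) (D.L.toUConf_toFun x) (D'.L.toUConf_toFun x) hx
      fun i => (D.f i).sec (a i)).trans ?_
    simp only [hcx]
    exact SymFib.of_sum (x := (⟨k, x⟩ : Conf M)) _ _ _ _

/-- The Cauchy symmetric bundle `S^⊠(V)` of a vector bundle `V` over `M`. -/
def symBundle (V : SmoothBundle.{u, v, w} E M) : ConfBundle.{u, v, max u w} E M where
  fib := SymFib V.fib
  str k :=
    { frames := range fun D : SymFrameData V k => D.toFrame
      covers := by
        intro x
        obtain ⟨L, hL⟩ := LocalOrdering.exists_mem_dom x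
        choose f hf hfx using fun i => V.str.covers ((L.toFun x).1 i)
        exact ⟨_, mem_range_self ⟨L, f, hf⟩, hL, hfx⟩
      compatible := by
        rintro _ ⟨D, rfl⟩ _ ⟨D', rfl⟩
        exact D.compatible D' }

end SymmetricBundle

end UConfBundles
end

open UConfBundles

noncomputable section

namespace UConfBundles

universe u v w w'

/-! ### Densities on a vector space -/

section DensityLine

variable {F : Type v} [AddCommGroup F] [Module ℝ F]

/-! The tangent space of `UConf k M` at x = {x₁, …, x_k} is the direct sum of the tangent spaces of
M at the xᵢ. A density on a direct sum of lines of data of this kind is a product of densities on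
the summands: this is the fibrewise isomorphism. It does not depend on the order of the points,
because permuting the summands has determinant ±1 and densities see only the absolute value.

To make this concrete, every tangent space is the model space, read through the preferred chart at
its base point. Both fibres over x are lines with a reference coordinate. On the left it is the
value of a density on a basis of `Fin k → E` assembled from copies of a basis of E. On the right it
is the coefficient along `symDensity`, the product of the densities |dx¹ ∧ … ∧ dx^d| of the
preferred charts at the points. `densEquiv` matches the two coordinates. The product basis makes it
the geometric isomorphism, since the product of the chart densities takes the value 1 there.

The reference elements are not smooth sections, because preferred charts jump from point to point;
smoothness has to be tested on the frames of a fixed chart. Such a frame is the Jacobian `chartJac`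
times the reference element. The heart of the proof is `UConf.chartJac_eq_prod`: the Jacobian of a
change of product charts is the product of the Jacobians on M. Hence the map carries a chart frame
to a constant multiple (`prodScale`) of a frame of the symmetric bundle (`densEquiv_densFrame`), and
smoothness in both directions follows from that of the transition matrices.

The product on densities is the one transported from the symmetric bundle. Since products of
reference elements are reference elements (`symMul_symDensity`), in coordinates it is multiplication
of real numbers (`densEval_mul`), so the algebra axioms are those of ℝ. Its smoothness follows
because a product of two frames is the frame of the concatenated ordering
(`symMul_symDensFrameData_sec`). -/

theorem Density.pull_eq_smul (b : Module.Basis (Fin (Module.finrank ℝ F)) ℝ F) (L : F →ₗ[ℝ] F) :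
    Density.pull b L = |LinearMap.det L| • Density.pull b (LinearMap.id : F →ₗ[ℝ] F) := by
  apply Subtype.ext
  funext v
  change |b.det (L ∘ v)| = |LinearMap.det L| * |b.det v|
  rw [← abs_mul, Module.Basis.det_comp]

theorem Density.pull_id_self (b : Module.Basis (Fin (Module.finrank ℝ F)) ℝ F) :
    (Density.pull b (LinearMap.id : F →ₗ[ℝ] F)).1 b = 1 := by
  change |b.det b| = 1
  rw [b.det_self, abs_one]

theorem Density.pull_id_ne_zero (b b' : Module.Basis (Fin (Module.finrank ℝ F)) ℝ F) :
    (Density.pull b (LinearMap.id : F →ₗ[ℝ] F)).1 b' ≠ 0 :=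
  abs_ne_zero.2 (b.isUnit_det b').ne_zero

/-- Automorphisms act transitively on bases, so a density is determined by its value on one of them.
-/
theorem Density.eq_apply_smul_pull (b : Module.Basis (Fin (Module.finrank ℝ F)) ℝ F)
    (ν : Density F) : ν = ν.1 b • Density.pull b (LinearMap.id : F →ₗ[ℝ] F) := by
  apply Subtype.ext
  funext w
  have hw : w = b.map (b.equiv w (Equiv.refl _)) := Module.Basis.eq_of_apply_eq fun i => by
    rw [Module.Basis.map_apply, Module.Basis.equiv_apply, Equiv.refl_apply]
  rw [hw]
  change ν.1 _ = ν.1 b * (Density.pull b LinearMap.id).1 _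
  rw [ν.2, (Density.pull b LinearMap.id).2, Density.pull_id_self]
  ring

/-- Evaluation at a basis identifies the line of densities with `ℝ`. -/
def Density.evalEquiv (b : Module.Basis (Fin (Module.finrank ℝ F)) ℝ F) : Density F ≃ₗ[ℝ] ℝ where
  toFun ν := ν.1 b
  map_add' _ _ := rfl
  map_smul' _ _ := rfl
  invFun r := r • Density.pull b (LinearMap.id : F →ₗ[ℝ] F)
  left_inv ν := (Density.eq_apply_smul_pull b ν).symm
  right_inv r := by
    change r * _ = r
    rw [Density.pull_id_self, mul_one]

end DensityLine

/-! ### Determinants of block-permuted maps -/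

section BlockDet

variable {k : ℕ} {E : Type v} [AddCommGroup E] [Module ℝ E] [FiniteDimensional ℝ E]

/-- A permutation of the blocks has finite order, so the absolute value of its determinant is a
nonnegative root of 1. The sign is not controlled: a transposition has determinant -1 when the
dimension of E is odd. -/
theorem abs_det_funLeft (σ : Equiv.Perm (Fin k)) :
    |LinearMap.det (LinearMap.funLeft ℝ E σ : (Fin k → E) →ₗ[ℝ] (Fin k → E))| = 1 := by
  have h : ∀ n : ℕ, (LinearMap.funLeft ℝ E σ : (Fin k → E) →ₗ[ℝ] (Fin k → E)) ^ n =
      LinearMap.funLeft ℝ E (σ ^ n : Equiv.Perm (Fin k)) := by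
    intro n
    induction n with
    | zero => rfl
    | succ n ih =>
      rw [pow_succ', ih, pow_succ]
      rfl
  have h1 := h (orderOf σ)
  rw [pow_orderOf_eq_one] at h1
  have h2 := congrArg (fun f => |LinearMap.det f|) h1
  simp only [map_pow, abs_pow] at h2
  refine (pow_eq_one_iff_of_nonneg (abs_nonneg _) (orderOf_pos σ).ne').1 (h2.trans ?_)
  change |LinearMap.det (LinearMap.id : (Fin k → E) →ₗ[ℝ] (Fin k → E))| = 1
  simp

/-- Such a map is a permutation of the blocks followed by a block-diagonal map, and the permutation
contributes only a sign. -/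
theorem abs_det_block (σ : Equiv.Perm (Fin k)) (f : Fin k → E →ₗ[ℝ] E)
    (L : (Fin k → E) →ₗ[ℝ] (Fin k → E)) (hL : ∀ v i, L v i = f i (v (σ i))) :
    |LinearMap.det L| = ∏ i, |LinearMap.det (f i)| := by
  have h : L = (LinearMap.pi fun i => f i ∘ₗ LinearMap.proj i) ∘ₗ LinearMap.funLeft ℝ E σ := by
    ext v i
    simp [hL, LinearMap.funLeft]
  rw [h, LinearMap.det_comp, abs_mul, abs_det_funLeft, mul_one, LinearMap.det_pi,
    Finset.abs_prod]

end BlockDet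

/-! ### Jacobians of chart changes and chart densities -/

section Jacobian

variable {E : Type v} [NormedAddCommGroup E] [NormedSpace ℝ E]
  {B : Type u} [TopologicalSpace B] [ChartedSpace E B] [IsManifold 𝓘(ℝ, E) ∞ B]

/-- The differential at `q` of the preferred chart at `p`, read in the preferred chart at `q`. -/
def chartDeriv (p q : B) : E →ₗ[ℝ] E :=
  (trivializationAt E (TangentSpace 𝓘(ℝ, E) : B → Type v) p).linearMapAt ℝ q

/-- Translates the trivialization of the tangent bundle into calculus on the model space, where the
chain rule can be applied. -/
theorem chartDeriv_eq_fderiv {p q : B} (hq : q ∈ (chartAt E p).source) :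
    chartDeriv (E := E) p q =
      (fderiv ℝ (chartAt E p ∘ (chartAt E q).symm) (chartAt E q q)).toLinearMap := by
  ext v
  -- The base set of the trivialization at p is by definition the source of the chart at p.
  have hq' : q ∈ (trivializationAt E (TangentSpace 𝓘(ℝ, E) : B → Type v) p).baseSet := hq
  change (trivializationAt E (TangentSpace 𝓘(ℝ, E) : B → Type v) p).linearMapAt ℝ q v = _
  rw [Bundle.Trivialization.linearMapAt_def_of_mem _ hq']
  change (trivializationAt E (TangentSpace 𝓘(ℝ, E) : B → Type v) p ⟨q, v⟩).2 = _
  rw [TangentBundle.trivializationAt_apply]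
  simp [fderivWithin_univ]

theorem differentiableAt_chartAt_comp_symm {p q : B} (hq : q ∈ (chartAt E p).source) :
    DifferentiableAt ℝ (chartAt E p ∘ (chartAt E q).symm) (chartAt E q q) := by
  have h1 : ContMDiffAt 𝓘(ℝ, E) 𝓘(ℝ, E) ∞ (chartAt E q).symm (chartAt E q q) :=
    contMDiffAt_symm_of_mem_maximalAtlas (IsManifold.chart_mem_maximalAtlas q)
      ((chartAt E q).map_source (mem_chart_source E q))
  have h2 : ContMDiffAt 𝓘(ℝ, E) 𝓘(ℝ, E) ∞ (chartAt E p)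
      ((chartAt E q).symm (chartAt E q q)) :=
    contMDiffAt_of_mem_maximalAtlas (IsManifold.chart_mem_maximalAtlas p)
      (by rwa [(chartAt E q).left_inv (mem_chart_source E q)])
  exact (h2.comp _ h1).contDiffAt.differentiableAt (by simp)

/-- The absolute value of the determinant of `chartDeriv`. -/
def chartJac (p q : B) : ℝ := |LinearMap.det (chartDeriv (E := E) p q)|

variable [FiniteDimensional ℝ E]

/-- The value at `q` of the density `|dx¹ ∧ … ∧ dx^d|` of the preferred chart at `q`. -/
def chartDensity (q : B) : Density (TangentSpace 𝓘(ℝ, E) q) :=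
  (Density.pull (Module.finBasis ℝ E) (LinearMap.id : E →ₗ[ℝ] E) : Density E)

/-- Separates the two dependences of the frame: `chartDensity` depends on q alone and need not vary
smoothly, while the fixed chart at p enters only through a scalar. -/
theorem densFrame_sec (p q : B) (a : (densFrame E B p).ι) :
    (densFrame E B p).sec a q = chartJac (E := E) p q • chartDensity (E := E) q :=
  Density.pull_eq_smul (F := E) (Module.finBasis ℝ E) (chartDeriv p q)

end Jacobian

/-! ### Preferred charts of the configuration space and their Jacobians -/

section ConfJacobian

variable {k : ℕ} {M : Type u} [TopologicalSpace M] [T2Space M]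

/-- The inverse of the quotient map near an ordered configuration, as a local ordering. -/
def OConf.localOrdering (f : OConf k M) : LocalOrdering k M :=
  haveI := Classical.decPred
    fun y => y ∈ (OConf.isLocalHomeomorph_toUConf.localInverseAt f).source
  -- A local ordering must order every configuration, so outside the domain an arbitrary ordering is
  -- taken; continuity is claimed only on the domain.
  { toFun := fun y => if y ∈ (OConf.isLocalHomeomorph_toUConf.localInverseAt f).source then
      OConf.isLocalHomeomorph_toUConf.localInverseAt f y else (OConf.toUConf_surjective y).choose
    toUConf_toFun := fun y => by
      split_ifs with h
      · exact OConf.isLocalHomeomorph_toUConf.apply_localInverseAt_of_mem h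
      · exact (OConf.toUConf_surjective y).choose_spec
    dom := (OConf.isLocalHomeomorph_toUConf.localInverseAt f).source
    isOpen_dom := (OConf.isLocalHomeomorph_toUConf.localInverseAt f).open_source
    continuousOn := (OConf.isLocalHomeomorph_toUConf.localInverseAt f).continuousOn.congr
      fun _ hy => if_pos hy }

theorem OConf.localOrdering_apply {f : OConf k M} {y : UConf k M}
    (hy : y ∈ f.localOrdering.dom) :
    f.localOrdering.toFun y = OConf.isLocalHomeomorph_toUConf.localInverseAt f y := if_pos hy

/-- The ordering of an unordered configuration used by the preferred chart at it. -/
def UConf.order (p : UConf k M) : OConf k M := (OConf.toUConf_surjective p).choose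

theorem UConf.toUConf_order (p : UConf k M) : p.order.toUConf = p :=
  (OConf.toUConf_surjective p).choose_spec

variable {E : Type v} [NormedAddCommGroup E] [NormedSpace ℝ E] [ChartedSpace E M]

theorem UConf.chartAt_eq (p : UConf k M) :
    chartAt (Fin k → E) p = confChart p.order fun i => chartAt E (p.order.1 i) := rfl

/-- The right-hand side is the domain condition of the symmetric frame built from the same ordering
and charts, so the two frames compared later have the same domain. -/
theorem UConf.mem_chartAt_source {p y : UConf k M} :
    y ∈ (chartAt (Fin k → E) p).source ↔ y ∈ p.order.localOrdering.dom ∧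
      ∀ i, (p.order.localOrdering.toFun y).1 i ∈ (chartAt E (p.order.1 i)).source := by
  rw [UConf.chartAt_eq, mem_confChart_source]
  refine and_congr_right fun h => ?_
  rw [OConf.localOrdering_apply h]

theorem UConf.chartAt_apply {p y : UConf k M} (hy : y ∈ (chartAt (Fin k → E) p).source)
    (i : Fin k) : chartAt (Fin k → E) p y i =
      chartAt E (p.order.1 i) ((p.order.localOrdering.toFun y).1 i) := by
  rw [OConf.localOrdering_apply (UConf.mem_chartAt_source.1 hy).1]
  rfl

theorem UConf.localOrdering_order_self (p : UConf k M) :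
    p.order.localOrdering.toFun p = p.order := by
  have h := OConf.isLocalHomeomorph_toUConf.localInverseAt_apply_self (x := p.order)
  rw [p.toUConf_order] at h
  have hp := OConf.isLocalHomeomorph_toUConf.apply_self_mem_localInverseAt_source (x := p.order)
  rw [p.toUConf_order] at hp
  rw [OConf.localOrdering_apply hp, h]

/-- The preferred chart at `y` is transformed into that at `p` by a block-permuted map. -/
theorem UConf.exists_chartAt_comp_symm {p y : UConf k M}
    (hy : y ∈ (chartAt (Fin k → E) p).source) :
    ∃ σ : Equiv.Perm (Fin k),
      (∀ i, (p.order.localOrdering.toFun y).1 i = y.order.1 (σ i)) ∧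
      ∀ᶠ w in 𝓝 (chartAt (Fin k → E) y y), ∀ i,
        (chartAt (Fin k → E) p ∘ (chartAt (Fin k → E) y).symm) w i =
          chartAt E (p.order.1 i) ((chartAt E (y.order.1 (σ i))).symm (w (σ i))) := by
  set c := chartAt (Fin k → E) y with hc
  have hyc : y ∈ c.source := mem_chart_source _ y
  have hsrc : ∀ w ∈ c.target, c.symm w ∈ c.source := fun w hw => c.map_target hw
  set L := y.order.localOrdering with hL
  have hzy : c.symm (c y) = y := c.left_inv hyc
  -- The ordering that underlies the chart at y, read through the inverse of that chart, is
  -- continuous at the centre; this makes its comparison with the ordering at p locally constant.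
  have ha : Tendsto (fun w => L.toFun (c.symm w)) (𝓝 (c y)) (𝓝 y.order) := by
    have h1 : ContinuousAt L.toFun y := L.continuousOn.continuousAt
      (L.isOpen_dom.mem_nhds (UConf.mem_chartAt_source.1 hyc).1)
    rw [ContinuousAt, UConf.localOrdering_order_self] at h1
    refine h1.comp ?_
    have h2 := (c.continuousAt_symm (c.map_source hyc)).tendsto
    rwa [hzy] at h2
  -- Two continuous orderings of the same configurations differ near y by one permutation σ, which
  -- therefore serves for the whole germ of the transition map.
  obtain ⟨σ, hσ⟩ := eventually_eq_confChart (UConf.chartAt_eq (E := E) p ▸ hy) ha y.toUConf_order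
  refine ⟨σ, fun i => ?_, ?_⟩
  -- At the centre itself the comparison says how the ordering chosen near p and the preferred
  -- ordering of y are related.
  · have h1 := (hσ.self_of_nhds i).2.2
    rw [L.toUConf_toFun, ← UConf.chartAt_eq, hzy, UConf.chartAt_apply hy,
      (chartAt E (p.order.1 i)).left_inv ((UConf.mem_chartAt_source.1 hy).2 i),
      UConf.localOrdering_order_self] at h1
    exact h1.symm
  · filter_upwards [hσ, c.open_target.mem_nhds (c.map_source hyc)] with w hw hwt i
    have h1 := (hw i).2.1
    rw [L.toUConf_toFun, ← UConf.chartAt_eq] at h1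
    rw [comp_apply, h1]
    congr 1
    have h2 : w (σ i) = chartAt E (y.order.1 (σ i)) ((L.toFun (c.symm w)).1 (σ i)) := by
      rw [← UConf.chartAt_apply (hsrc w hwt), ← hc, c.right_inv hwt]
    rw [h2, (chartAt E (y.order.1 (σ i))).left_inv
      ((UConf.mem_chartAt_source.1 (hsrc w hwt)).2 (σ i))]

theorem UConf.chartAt_self_apply (y : UConf k M) (i : Fin k) :
    chartAt (Fin k → E) y y i = chartAt E (y.order.1 i) (y.order.1 i) := by
  rw [UConf.chartAt_apply (mem_chart_source _ y), UConf.localOrdering_order_self]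

variable [IsManifold 𝓘(ℝ, E) ∞ M]

variable [FiniteDimensional ℝ E]

/-- The i-th component of the change of product charts is a chart change of M applied to the
coordinate numbered σ i. The differential is thus block-permuted, with blocks the differentials on
M. -/
theorem UConf.chartJac_eq_prod {p y : UConf k M} (hy : y ∈ (chartAt (Fin k → E) p).source) :
    chartJac (E := Fin k → E) p y =
      ∏ i, chartJac (E := E) (p.order.1 i) ((p.order.localOrdering.toFun y).1 i) := by
  obtain ⟨σ, hσ, hev⟩ := UConf.exists_chartAt_comp_symm hy
  refine abs_det_block σ _ _ fun v i => ?_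
  have hsrc := (UConf.mem_chartAt_source.1 hy).2 i
  rw [chartDeriv_eq_fderiv hy, chartDeriv_eq_fderiv hsrc, hσ i]
  rw [hσ i] at hsrc
  -- Chain rule for the i-th component: projection to the coordinate numbered σ i, followed by a
  -- chart change of M.
  have hdi : HasFDerivAt (fun w : Fin k → E => (chartAt (Fin k → E) p ∘
      (chartAt (Fin k → E) y).symm) w i)
      ((fderiv ℝ (chartAt E (p.order.1 i) ∘ (chartAt E (y.order.1 (σ i))).symm)
        (chartAt E (y.order.1 (σ i)) (y.order.1 (σ i)))).comp
        (ContinuousLinearMap.proj (σ i))) (chartAt (Fin k → E) y y) := by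
    refine HasFDerivAt.congr_of_eventuallyEq ?_ (hev.mono fun w hw => hw i)
    have h1 := (differentiableAt_chartAt_comp_symm hsrc).hasFDerivAt
    rw [← UConf.chartAt_self_apply (E := E) y (σ i)] at h1 ⊢
    exact HasFDerivAt.comp (f := fun w : Fin k → E => w (σ i)) _ h1
      (ContinuousLinearMap.proj (R := ℝ) (φ := fun _ : Fin k => E) (σ i)).hasFDerivAt
  have hfull := (differentiableAt_chartAt_comp_symm (E := Fin k → E) hy).hasFDerivAt
  -- The i-th component of the full differential is identified with the block by uniqueness of
  -- derivatives.
  have := ((hasFDerivAt_pi'.1 hfull i).unique hdi)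
  exact congrArg (fun T : (Fin k → E) →L[ℝ] E => T v) this

end ConfJacobian

/-! ### The lines of symmetric densities and the fibrewise isomorphism -/

section SymmetricLine

variable {M : Type u}

theorem SymFib.of_smul {V : M → Type w} [∀ p, AddCommGroup (V p)] [∀ p, Module ℝ (V p)]
    {x : Conf M} (e : Fin x.1 ≃ x.pts) (c : Fin x.1 → ℝ) (v : ∀ i, V (e i)) :
    SymFib.of e (fun i => c i • v i) = (∏ i, c i) • SymFib.of e v := by
  change SymFib.equiv V e (PiTensorProduct.tprod ℝ _) = _
  rw [MultilinearMap.map_smul_univ, map_smul]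
  rfl

/-- One family u on the points of x supplies both factors by restriction, which avoids gluing
dependent families over y and z. -/
theorem symMul_of {V : M → Type w} [∀ p, AddCommGroup (V p)] [∀ p, Module ℝ (V p)]
    {x y z : Conf M} (h : IsSplit x y z) (e : Fin y.1 ≃ y.pts) (e' : Fin z.1 ≃ z.pts)
    (u : ∀ p : x.pts, V p) :
    symMul V h (SymFib.of e fun i => u (h.ptsEquiv (Sum.inl (e i))))
      (SymFib.of e' fun j => u (h.ptsEquiv (Sum.inr (e' j)))) =
    SymFib.of (h.concat e e') fun i => u (h.concat e e' i) :=
  congrArg (symRel V x).mkQ (tensorMul_of V h e e' u)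

/-- An ordering of the points of a configuration. -/
def Conf.ordering (x : Conf M) : Fin x.1 ≃ x.pts := (Finset.equivFinOfCardEq x.2.2).symm

variable (E : Type v) [NormedAddCommGroup E] [NormedSpace ℝ E] [FiniteDimensional ℝ E]
  [TopologicalSpace M] [ChartedSpace E M] [IsManifold 𝓘(ℝ, E) ∞ M]

/-- The tensor product of the densities `|dx¹ ∧ … ∧ dx^d|` of the preferred charts at the points
of a configuration. -/
def symDensity (x : Conf M) : SymFib (densBundle E M).fib x :=
  SymFib.of x.ordering fun i => chartDensity (E := E) (x.ordering i).1

/-- The factors are indexed by the points and not by their positions, so the ordering is immaterial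
in the quotient. -/
theorem symDensity_eq {x : Conf M} (e : Fin x.1 ≃ x.pts) :
    symDensity E x = SymFib.of (V := (densBundle E M).fib) e
      fun i => chartDensity (E := E) (e i).1 :=
  SymFib.of_congr (V := (densBundle E M).fib) _ e fun p => chartDensity (E := E) p.1

/-- Concatenating the chart densities over y and over z gives the chart densities over x in some
ordering. This multiplicativity of the reference elements is what turns ⊡ into multiplication of
reals. -/
theorem symMul_symDensity {x y z : Conf M} (h : IsSplit x y z) :
    symMul (densBundle E M).fib h (symDensity E y) (symDensity E z) = symDensity E x :=
  (symMul_of (V := (densBundle E M).fib) h y.ordering z.ordering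
    fun p => chartDensity (E := E) p.1).trans (symDensity_eq E _).symm

theorem symOne_eq : symOne (densBundle E M).fib = symDensity E Conf.empty := by
  rw [symOne, symDensity_eq]
  exact congrArg _ (funext fun i => Fin.elim0 i)

theorem exists_basis_chartDensity (q : M) :
    ∃ b : Module.Basis Unit ℝ ((densBundle E M).fib q), ∀ a, b a = chartDensity (E := E) q :=
  Density.exists_basis (V := E) _ (Module.finBasis ℝ E)
    (Density.pull_id_ne_zero (Module.finBasis ℝ E) _)

/-- A tensor product of lines is a line: the index type `Fin x.1 → Unit` has exactly one element,
also over the empty configuration. -/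
theorem exists_basis_symDensity (x : Conf M) :
    ∃ b : Module.Basis (Fin x.1 → Unit) ℝ (SymFib (densBundle E M).fib x),
      ∀ a, b a = symDensity E x :=
  SymFib.exists_basis (V := (densBundle E M).fib) x.ordering (fun _ => Unit)
    (fun i _ => chartDensity (E := E) (x.ordering i).1)
    fun i => exists_basis_chartDensity E (x.ordering i).1

/-- The fibres of the Cauchy symmetric bundle of the density bundle are lines. -/
def symLine (x : Conf M) : ℝ ≃ₗ[ℝ] SymFib (densBundle E M).fib x :=
  ((exists_basis_symDensity E x).choose.equivFun.trans
    (LinearEquiv.funUnique (Fin x.1 → Unit) ℝ ℝ)).symm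

theorem symLine_apply (x : Conf M) (r : ℝ) : symLine E x r = r • symDensity E x := by
  rw [symLine, LinearEquiv.symm_apply_eq]
  refine Eq.trans ?_ (congrArg (fun t => ((exists_basis_symDensity E x).choose.equivFun.trans
    (LinearEquiv.funUnique (Fin x.1 → Unit) ℝ ℝ)) (r • t))
    ((exists_basis_symDensity E x).choose_spec default))
  simp

/-- The product of copies of a basis of `E`, as a basis of `Fin k → E`. -/
def prodBasis (k : ℕ) : Module.Basis (Fin (Module.finrank ℝ (Fin k → E))) ℝ (Fin k → E) :=
  (Pi.basis fun _ : Fin k => Module.finBasis ℝ E).reindex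
    (Fintype.equivFinOfCardEq
      (Module.finrank_eq_card_basis (Pi.basis fun _ : Fin k => Module.finBasis ℝ E)).symm)

variable [T2Space M]

/-- The isomorphism of a density `ν` at `x = {x₁, …, x_k}` with a multiple of the product of
densities at `x₁, …, x_k`; the factor is the value of `ν` on the product basis. -/
def densEquiv (x : Conf M) : (densConfBundle E M).fib x ≃ₗ[ℝ] SymFib (densBundle E M).fib x :=
  (Density.evalEquiv (F := Fin x.1 → E) (prodBasis E x.1)).trans (symLine E x)

theorem symMul_densEquiv {x y z : Conf M} (h : IsSplit x y z) (a : (densConfBundle E M).fib y)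
    (b : (densConfBundle E M).fib z) :
    symMul (densBundle E M).fib h (densEquiv E y a) (densEquiv E z b) =
      ((Density.evalEquiv (F := Fin y.1 → E) (prodBasis E y.1) a) *
        (Density.evalEquiv (F := Fin z.1 → E) (prodBasis E z.1) b)) • symDensity E x := by
  change symMul (densBundle E M).fib h (symLine E y _) (symLine E z _) = _
  rw [symLine_apply, symLine_apply, map_smul, map_smul, LinearMap.smul_apply, symMul_symDensity,
    smul_smul, mul_comm]
  rfl

end SymmetricLine

/-! ### The isomorphism on chart frames -/

section KeyIdentity

variable {E : Type v} [NormedAddCommGroup E] [NormedSpace ℝ E] [FiniteDimensional ℝ E]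
  {M : Type u} [TopologicalSpace M] [T2Space M] [ChartedSpace E M] [IsManifold 𝓘(ℝ, E) ∞ M]
  {k : ℕ}

/-- The local frame of `S^⊠(Dens_M)` given by a local ordering and density frames. -/
def symDensFrameData (L : LocalOrdering k M) (p : Fin k → M) :
    SymFrameData (densBundle E M) k where
  L := L
  f i := densFrame E M (p i)
  f_mem _ := mem_range_self _

theorem symDensFrameData_sec (L : LocalOrdering k M) (p : Fin k → M) (y : UConf k M)
    (a : (symDensFrameData (E := E) L p).toFrame.ι) :
    (symDensFrameData (E := E) L p).toFrame.sec a y =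
      (∏ i, chartJac (E := E) (p i) ((L.toFun y).1 i)) • symDensity E (⟨k, y⟩ : Conf M) := by
  rw [symDensity_eq E (x := (⟨k, y⟩ : Conf M)) ((L.toFun y).ordering (L.toUConf_toFun y))]
  refine Eq.trans ?_ (SymFib.of_smul (V := (densBundle E M).fib) (x := (⟨k, y⟩ : Conf M)) _ _ _)
  exact congrArg (SymFib.of (V := (densBundle E M).fib) (x := (⟨k, y⟩ : Conf M)) _)
    (funext fun i => densFrame_sec (p i) ((L.toFun y).1 i) _)

variable (E) in
/-- The value on the product basis of the density of the standard basis of `Fin k → E`. -/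
def prodScale (k : ℕ) : ℝ :=
  (Density.pull (Module.finBasis ℝ (Fin k → E)) (LinearMap.id : (Fin k → E) →ₗ[ℝ] _)).1
    (prodBasis E k)

theorem prodScale_ne_zero : prodScale E k ≠ 0 := Density.pull_id_ne_zero _ _

/-- Both sides are a Jacobian times `symDensity`, and the Jacobians agree by
`UConf.chartJac_eq_prod`. What remains is the ratio between the standard and the product basis of
`Fin k → E`, which depends on k but not on y. The indices a and b range over one-element types. -/
theorem densEquiv_densFrame {p y : UConf k M} (hy : y ∈ (chartAt (Fin k → E) p).source)
    (a : (densFrame (Fin k → E) (UConf k M) p).ι)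
    (b : (symDensFrameData (E := E) p.order.localOrdering p.order.1).toFrame.ι) :
    densEquiv E (⟨k, y⟩ : Conf M) ((densFrame (Fin k → E) (UConf k M) p).sec a y) =
      prodScale E k •
        (symDensFrameData (E := E) p.order.localOrdering p.order.1).toFrame.sec b y := by
  rw [densFrame_sec, symDensFrameData_sec, UConf.chartJac_eq_prod hy]
  change symLine E (⟨k, y⟩ : Conf M) (_ * prodScale E k) = _
  rw [symLine_apply, mul_comm, smul_smul]

end KeyIdentity

/-! ### Smoothness of the isomorphism and of its inverse -/

section DensSmooth

variable {E : Type v} [NormedAddCommGroup E] [NormedSpace ℝ E] [FiniteDimensional ℝ E]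
  {M : Type u} [TopologicalSpace M] [T2Space M] [ChartedSpace E M] [IsManifold 𝓘(ℝ, E) ∞ M]
  {k : ℕ}

/-- The image of the chart frame at p is a constant times a symmetric frame, so the matrix against D
is that constant times a transition matrix of the symmetric bundle. -/
theorem densEquiv_isSmoothIn (p : UConf k M) (D : SymFrameData (densBundle E M) k) :
    IsSmoothIn (Fin k → E)
      (fun x : UConf k M => (densEquiv E (⟨k, x⟩ : Conf M)).toLinearMap)
      (densFrame (Fin k → E) (UConf k M) p) D.toFrame := by
  rintro x ⟨hx, hxD⟩
  have hx' : x ∈ (chartAt (Fin k → E) p).source := hx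
  obtain ⟨c, hc, hcs⟩ := (symDensFrameData (E := E) p.order.localOrdering p.order.1).compatible D x
    ⟨UConf.mem_chartAt_source.1 hx', hxD⟩
  refine ⟨fun _ b y => prodScale E k * c (fun _ => ()) b y,
    fun _ b => contMDiffAt_const.mul (hc _ b), ?_⟩
  filter_upwards [hcs, (chartAt (Fin k → E) p).open_source.mem_nhds hx'] with y hy hyp a
  refine (densEquiv_densFrame hyp a fun _ => ()).trans ?_
  refine (congrArg (prodScale E k • ·) (hy fun _ => ())).trans ?_
  refine Finset.smul_sum.trans (Finset.sum_congr rfl fun b _ => ?_)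
  exact smul_smul _ _ _

theorem densEquiv_symm_isSmoothIn (D : SymFrameData (densBundle E M) k) (p : UConf k M) :
    IsSmoothIn (Fin k → E)
      (fun x : UConf k M => (densEquiv E (⟨k, x⟩ : Conf M)).symm.toLinearMap)
      D.toFrame (densFrame (Fin k → E) (UConf k M) p) := by
  rintro x ⟨hxD, hx⟩
  have hx' : x ∈ (chartAt (Fin k → E) p).source := hx
  obtain ⟨c, hc, hcs⟩ := D.compatible
    (symDensFrameData (E := E) p.order.localOrdering p.order.1) x
    ⟨hxD, UConf.mem_chartAt_source.1 hx'⟩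
  -- The symmetric frame at p has a single section, so the sum over b is just its one coefficient;
  -- the inverse of `prodScale` undoes the constant in `densEquiv_densFrame`.
  refine ⟨fun a _ y => (∑ b, c a b y) * (prodScale E k)⁻¹,
    fun a _ => (contMDiffAt_finsetSum fun b _ => hc a b).mul contMDiffAt_const, ?_⟩
  filter_upwards [hcs, (chartAt (Fin k → E) p).open_source.mem_nhds hx'] with y hy hyp a
  refine Eq.trans ?_ (Fintype.sum_unique (ι := Unit) _).symm
  refine (LinearEquiv.symm_apply_eq _).2 (Eq.trans (hy a) ?_)
  refine Eq.trans ?_ (map_smul (densEquiv E (⟨k, y⟩ : Conf M)) _ _).symm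
  refine Eq.trans ?_ (congrArg (((∑ b, c a b y) * (prodScale E k)⁻¹) • ·)
    (densEquiv_densFrame hyp () fun _ => ())).symm
  refine Eq.trans ?_ (smul_smul _ _ _).symm
  rw [inv_mul_cancel_right₀ prodScale_ne_zero]
  exact (Finset.sum_smul (f := fun b => c a b y) (x := (symDensFrameData (E := E)
    p.order.localOrdering p.order.1).toFrame.sec (fun _ => ()) y)).symm

variable (E M) in
/-- The isomorphism of the density bundle of `UConf(M)` with `S^⊠(Dens_M)`. -/
def densIso : ConfBundle.Iso (densConfBundle E M) (symBundle (densBundle E M)) where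
  toEquiv := densEquiv E
  smooth := by
    rintro k _ ⟨p, rfl⟩ _ ⟨D, rfl⟩
    exact densEquiv_isSmoothIn p D
  smooth_symm := by
    rintro k _ ⟨D, rfl⟩ _ ⟨p, rfl⟩
    exact densEquiv_symm_isSmoothIn D p

end DensSmooth

/-! ### Concatenation of local orderings of complementary subconfigurations -/

section Concatenation

variable {M : Type u} {k : ℕ}

/-- The identification of `{1, …, k}` with the disjoint union of `I` and its complement, both
enumerated. -/
def concatIndex (I : Finset (Fin k)) : Fin k ≃ Fin I.card ⊕ Fin Iᶜ.card :=
  (finCongr (by rw [Finset.card_add_card_compl, Fintype.card_fin])).trans finSumFinEquiv.symm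

/-- The concatenation of orderings of two complementary subconfigurations. -/
def OConf.concat {x : UConf k M} {I : Finset (Fin k)} {f : OConf k M} (hf : f.toUConf = x)
    {g : OConf I.card M} (hg : g.toUConf = f.sub I) {g' : OConf Iᶜ.card M}
    (hg' : g'.toUConf = f.sub Iᶜ) : OConf k M :=
  ⟨fun i => Sum.elim g.1 g'.1 (concatIndex I i), by
    refine (g.2.sumElim g'.2 fun a b hab => ?_).comp (concatIndex I).injective
    have h1 : g.1 a ∈ (f.sub I).1 := hg ▸ g.mem_toUConf a
    have h2 : g'.1 b ∈ (f.sub Iᶜ).1 := hg' ▸ g'.mem_toUConf b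
    exact Finset.disjoint_left.1 (f.split hf I).isSplit.1 h1 (hab ▸ h2)⟩

theorem OConf.toUConf_concat {x : UConf k M} {I : Finset (Fin k)} {f : OConf k M}
    (hf : f.toUConf = x) {g : OConf I.card M} (hg : g.toUConf = f.sub I) {g' : OConf Iᶜ.card M}
    (hg' : g'.toUConf = f.sub Iᶜ) : (OConf.concat hf hg hg').toUConf = x := by
  classical
  apply Subtype.ext
  ext p
  have h : p ∈ x.1 ↔ p ∈ (f.sub I).1 ∨ p ∈ (f.sub Iᶜ).1 := by
    change p ∈ Conf.pts (⟨k, x⟩ : Conf M) ↔ _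
    rw [← (f.split hf I).isSplit.2]
    exact Finset.mem_union
  rw [h, ← hg, ← hg', OConf.mem_toUConf_iff, OConf.mem_toUConf_iff, OConf.mem_toUConf_iff]
  exact ((concatIndex I).surjective.exists (p := fun s => Sum.elim g.1 g'.1 s = p)).symm.trans
    Sum.exists

variable (E : Type v) [NormedAddCommGroup E] [NormedSpace ℝ E]
  [TopologicalSpace M] [T2Space M] [ChartedSpace E M] [IsManifold 𝓘(ℝ, E) ∞ M]

/-- The concatenation of local orderings of the subconfigurations with indices in `I` and in its
complement. -/
def LocalOrdering.concat (L : LocalOrdering k M) (I : Finset (Fin k))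
    (L₁ : LocalOrdering I.card M) (L₂ : LocalOrdering Iᶜ.card M) : LocalOrdering k M where
  toFun y := OConf.concat (L.toUConf_toFun y) (L₁.toUConf_toFun ((L.toFun y).sub I))
    (L₂.toUConf_toFun ((L.toFun y).sub Iᶜ))
  toUConf_toFun y := OConf.toUConf_concat _ _ _
  dom := {y | y ∈ L.dom ∧ (L.toFun y).sub I ∈ L₁.dom ∧ (L.toFun y).sub Iᶜ ∈ L₂.dom}
  isOpen_dom := by
    rw [isOpen_iff_mem_nhds]
    rintro y ⟨hy, h1, h2⟩
    exact (L.isOpen_dom.eventually_mem hy).and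
      (((L.contMDiffAt_sub (E := E) hy I).continuousAt.eventually_mem
        (L₁.isOpen_dom.mem_nhds h1)).and
      ((L.contMDiffAt_sub (E := E) hy Iᶜ).continuousAt.eventually_mem
        (L₂.isOpen_dom.mem_nhds h2)))
  continuousOn := by
    rintro y ⟨hy, h1, h2⟩
    refine ContinuousAt.continuousWithinAt ?_
    have hc1 : ContinuousAt (fun y => L₁.toFun ((L.toFun y).sub I)) y :=
      (L₁.continuousOn.continuousAt (L₁.isOpen_dom.mem_nhds h1)).comp
        (f := fun y => (L.toFun y).sub I) (L.contMDiffAt_sub (E := E) hy I).continuousAt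
    have hc2 : ContinuousAt (fun y => L₂.toFun ((L.toFun y).sub Iᶜ)) y :=
      (L₂.continuousOn.continuousAt (L₂.isOpen_dom.mem_nhds h2)).comp
        (f := fun y => (L.toFun y).sub Iᶜ) (L.contMDiffAt_sub (E := E) hy Iᶜ).continuousAt
    -- Ordered configurations carry the topology of M^k, so continuity is checked point by point,
    -- and each point comes from one of the two parts.
    rw [OConf.isOpenEmbedding_val.isInducing.continuousAt_iff]
    refine continuousAt_pi.2 fun i => ?_
    change ContinuousAt (fun y => Sum.elim (L₁.toFun ((L.toFun y).sub I)).1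
      (L₂.toFun ((L.toFun y).sub Iᶜ)).1 (concatIndex I i)) y
    rcases concatIndex I i with j | j
    · exact (OConf.continuous_apply j).continuousAt.comp hc1
    · exact (OConf.continuous_apply j).continuousAt.comp hc2

end Concatenation

theorem map_bilin_smul_smul {V W N P : Type*} [AddCommGroup V] [Module ℝ V] [AddCommGroup W]
    [Module ℝ W] [AddCommGroup N] [Module ℝ N] [AddCommGroup P] [Module ℝ P]
    (β : V →ₗ[ℝ] W →ₗ[ℝ] N) (φ : N →ₗ[ℝ] P) (s t : ℝ) (a : V) (b : W) :
    φ (β (s • a) (t • b)) = (t * s) • φ (β a b) := by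
  rw [map_smul, map_smul, map_smul, LinearMap.smul_apply, map_smul, smul_smul]

/-! ### The product of densities: smoothness and algebra axioms -/

section DensAlgebra

variable {E : Type v} [NormedAddCommGroup E] [NormedSpace ℝ E] [FiniteDimensional ℝ E]
  {M : Type u} [TopologicalSpace M] [T2Space M] [ChartedSpace E M] [IsManifold 𝓘(ℝ, E) ∞ M]
  {k : ℕ}

/-- Each section is a product of Jacobians times `symDensity`. The reference elements multiply, and
the product of Jacobians for the concatenated ordering splits into those over `I` and over its
complement. -/
theorem symMul_symDensFrameData_sec (L : LocalOrdering k M) (I : Finset (Fin k))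
    (L₁ : LocalOrdering I.card M) (L₂ : LocalOrdering Iᶜ.card M) (p : Fin I.card → M)
    (q : Fin Iᶜ.card → M) (y : UConf k M)
    (h : IsSplit (⟨k, y⟩ : Conf M) ⟨_, (L.toFun y).sub I⟩ ⟨_, (L.toFun y).sub Iᶜ⟩)
    (a : (symDensFrameData (E := E) L₁ p).toFrame.ι)
    (b : (symDensFrameData (E := E) L₂ q).toFrame.ι)
    (c : (symDensFrameData (E := E) (L.concat E I L₁ L₂)
      fun i => Sum.elim p q (concatIndex I i)).toFrame.ι) :
    symMul (densBundle E M).fib h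
      ((symDensFrameData (E := E) L₁ p).toFrame.sec a ((L.toFun y).sub I))
      ((symDensFrameData (E := E) L₂ q).toFrame.sec b ((L.toFun y).sub Iᶜ)) =
    (symDensFrameData (E := E) (L.concat E I L₁ L₂)
      fun i => Sum.elim p q (concatIndex I i)).toFrame.sec c y := by
  rw [symDensFrameData_sec, symDensFrameData_sec, symDensFrameData_sec, map_smul, map_smul,
    LinearMap.smul_apply, symMul_symDensity, smul_smul]
  congr 1
  rw [mul_comm]
  refine Eq.trans ?_ (Equiv.prod_comp (concatIndex I) fun s => chartJac (E := E) (Sum.elim p q s)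
    (Sum.elim (L₁.toFun ((L.toFun y).sub I)).1 (L₂.toFun ((L.toFun y).sub Iᶜ)).1 s)).symm
  rw [Fintype.prod_sum_type]
  rfl

variable (E) in
/-- The product of densities corresponding to the product of `S^⊠(Dens_M)`. -/
def densMul (x : Conf M) :
    CauchyFib (densConfBundle E M).fib (densConfBundle E M).fib x →ₗ[ℝ]
      (densConfBundle E M).fib x :=
  (densEquiv E x).symm.toLinearMap ∘ₗ DirectSum.toModule ℝ (Split x) _ fun p =>
    TensorProduct.lift ((symMul (densBundle E M).fib p.isSplit).compl₁₂
      (densEquiv E p.fst).toLinearMap (densEquiv E p.snd).toLinearMap)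

theorem densMul_lof {x : Conf M} (p : Split x) (a : (densConfBundle E M).fib p.fst)
    (b : (densConfBundle E M).fib p.snd) :
    densMul E x (DirectSum.lof ℝ (Split x)
      (fun p => (densConfBundle E M).fib p.fst ⊗[ℝ] (densConfBundle E M).fib p.snd) p
      (a ⊗ₜ[ℝ] b)) =
    (densEquiv E x).symm (symMul (densBundle E M).fib p.isSplit (densEquiv E p.fst a)
      (densEquiv E p.snd b)) := by
  rw [densMul, LinearMap.comp_apply, DirectSum.toModule_lof]
  rfl

/-- On the summand of an index set I, the isomorphism takes the two density frames to constants
times symmetric frames, whose product is again a symmetric frame. The product of densities on this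
summand is therefore a constant times the inverse isomorphism on a frame, which is already known to
be smooth. -/
theorem densMul_isSmoothIn (D : CauchyFrameData (densConfBundle E M) (densConfBundle E M) k)
    (p : UConf k M) :
    IsSmoothIn (Fin k → E) (fun x : UConf k M => densMul E (⟨k, x⟩ : Conf M))
      D.toFrame (densFrame (Fin k → E) (UConf k M) p) := by
  obtain ⟨L, f, f_mem, g, g_mem⟩ := D
  -- Every frame of the density bundle is that of a preferred chart; q and r are the base points of
  -- these charts for the two factors, and the frames are replaced by them.
  choose q hq using fun I => f_mem I
  choose r hr using fun I => g_mem I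
  obtain rfl : (fun I => densFrame (Fin I.card → E) (UConf I.card M) (q I)) = f := funext hq
  obtain rfl : (fun I : Finset (Fin k) => densFrame (Fin Iᶜ.card → E) (UConf Iᶜ.card M) (r I)) =
    g := funext hr
  rintro x ⟨hxD, hx⟩
  -- The symmetric frame that is the product of the two frames for I: orderings and base points of
  -- charts are concatenated in the same way.
  let D' : Finset (Fin k) → SymFrameData (densBundle E M) k := fun I =>
    symDensFrameData (E := E)
      (L.concat E I (q I).order.localOrdering (r I).order.localOrdering)
      fun i => Sum.elim (q I).order.1 (r I).order.1 (concatIndex I i)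
  have hmem : ∀ I, x ∈ (D' I).toFrame.dom := by
    intro I
    have h1 := (UConf.mem_chartAt_source (E := E)).1 (hxD.2 I).1
    have h2 := (UConf.mem_chartAt_source (E := E)).1 (hxD.2 I).2
    refine ⟨⟨hxD.1, h1.1, h2.1⟩, fun i => ?_⟩
    change Sum.elim ((q I).order.localOrdering.toFun ((L.toFun x).sub I)).1
      ((r I).order.localOrdering.toFun ((L.toFun x).sub Iᶜ)).1 (concatIndex I i) ∈
      (chartAt E (Sum.elim (q I).order.1 (r I).order.1 (concatIndex I i))).source
    rcases concatIndex I i with j | j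
    · exact h1.2 j
    · exact h2.2 j
  choose c hc hcs using fun I => densEquiv_symm_isSmoothIn (D' I) p x ⟨hmem I, hx⟩
  -- One `prodScale` comes from each tensor factor, the last term from the inverse isomorphism on
  -- the product frame.
  refine ⟨fun a b y => prodScale E a.1ᶜ.card * prodScale E a.1.card * c a.1 (fun _ => ()) b y,
    fun a b => contMDiffAt_const.mul (hc a.1 _ b), ?_⟩
  filter_upwards [eventually_all.2 hcs,
    (LocalFrame.isOpen_dom (CauchyFrameData.toFrame _)).mem_nhds hxD] with y hy hyD a
  obtain ⟨I, a, b⟩ := a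
  refine (densMul_lof ((L.toFun y).split (L.toUConf_toFun y) I) _ _).trans ?_
  have h1 := densEquiv_densFrame (E := E) (p := q I) (y := (L.toFun y).sub I) (hyD.2 I).1 a
    fun _ => ()
  have h2 := densEquiv_densFrame (E := E) (p := r I) (y := (L.toFun y).sub Iᶜ) (hyD.2 I).2 b
    fun _ => ()
  refine (congrArg₂ (fun s t => (densEquiv E (⟨k, y⟩ : Conf M)).symm
    (symMul (densBundle E M).fib ((L.toFun y).split (L.toUConf_toFun y) I).isSplit s t))
    h1 h2).trans ?_
  refine (map_bilin_smul_smul (symMul (densBundle E M).fib _)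
    (densEquiv E (⟨k, y⟩ : Conf M)).symm.toLinearMap _ _ _ _).trans ?_
  refine (congrArg (fun t => (prodScale E Iᶜ.card * prodScale E I.card) •
    (densEquiv E (⟨k, y⟩ : Conf M)).symm t)
    (symMul_symDensFrameData_sec L I _ _ _ _ y _ _ _ fun _ => ())).trans ?_
  refine (congrArg ((prodScale E Iᶜ.card * prodScale E I.card) • ·) (hy I fun _ => ())).trans ?_
  refine (Finset.smul_sum (f := fun j => c I (fun _ => ()) j y •
    (densFrame (Fin k → E) (UConf k M) p).sec j y)).trans (Finset.sum_congr rfl fun j _ => ?_)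
  exact smul_smul _ _ _

variable (E M) in
/-- The product of the density bundle of `UConf(M)`, as a smooth bundle map. -/
def densMulHom :
    ConfBundle.Hom ((densConfBundle E M).cauchy (densConfBundle E M)) (densConfBundle E M) where
  toFun := densMul E
  smooth := by
    rintro k _ ⟨D, rfl⟩ _ ⟨p, rfl⟩
    exact densMul_isSmoothIn D p

theorem densEquiv_mul {x y z : Conf M} (h : IsSplit x y z) (a : (densConfBundle E M).fib y)
    (b : (densConfBundle E M).fib z) :
    densEquiv E x ((densMulHom E M).mul h a b) =
      symMul (densBundle E M).fib h (densEquiv E y a) (densEquiv E z b) :=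
  (LinearEquiv.eq_symm_apply _).1 (densMul_lof ⟨y, z, h⟩ a b)

variable (E) in
/-- The value of a density at a configuration on the product basis. -/
def densEval (x : Conf M) : (densConfBundle E M).fib x ≃ₗ[ℝ] ℝ :=
  Density.evalEquiv (F := Fin x.1 → E) (prodBasis E x.1)

/-- Since `symLine` is injective, the multiplicativity of the reference elements can be read off in
ℝ. Associativity, unitality and commutativity of the product then become those of real
multiplication. -/
theorem densEval_mul {x y z : Conf M} (h : IsSplit x y z) (a : (densConfBundle E M).fib y)
    (b : (densConfBundle E M).fib z) :
    densEval E x ((densMulHom E M).mul h a b) = densEval E y a * densEval E z b := by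
  apply (symLine E x).injective
  refine (densEquiv_mul h a b).trans ((symMul_densEquiv E h a b).trans ?_)
  exact (symLine_apply E x _).symm

variable (E M) in
/-- The commutative `⊠`-algebra structure of the density bundle of `UConf(M)`. -/
def densAlgebra : CommCauchyAlgebra (densConfBundle E M) where
  m := densMulHom E M
  one := (densEval E Conf.empty).symm 1
  assoc _ _ _ _ a b c := (densEval E _).injective <| by simp only [densEval_mul, mul_assoc]
  mul_one _ a := (densEval E _).injective <| by
    rw [densEval_mul, LinearEquiv.apply_symm_apply, mul_one]
  one_mul _ a := (densEval E _).injective <| by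
    rw [densEval_mul, LinearEquiv.apply_symm_apply, one_mul]
  comm _ a b := (densEval E _).injective <| by simp only [densEval_mul, mul_comm]

/-- Over the empty configuration the reference element is the empty tensor, and the unit is the
density of coordinate 1. -/
theorem densEquiv_one :
    densEquiv E Conf.empty (densAlgebra E M).one = symOne (densBundle E M).fib := by
  rw [symOne_eq]
  change symLine E _ (densEval E Conf.empty ((densEval E Conf.empty).symm 1)) = _
  rw [LinearEquiv.apply_symm_apply, symLine_apply, one_smul]

end DensAlgebra

end UConfBundles

end

theorem mainTheorem4 {E : Type*} [NormedAddCommGroup E] [NormedSpace ℝ E] [FiniteDimensional ℝ E]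
    {M : Type*} [TopologicalSpace M] [T2Space M] [ChartedSpace E M] [IsManifold 𝓘(ℝ, E) ∞ M] :
    ∃ (Φ : ConfBundle.Iso (densConfBundle E M) (symBundle (densBundle E M)))
      (A : CommCauchyAlgebra (densConfBundle E M)),
      (∀ {x y z : Conf M} (h : IsSplit x y z) (a : (densConfBundle E M).fib y)
          (b : (densConfBundle E M).fib z),
        Φ.toEquiv x (A.m.mul h a b) =
          symMul (densBundle E M).fib h (Φ.toEquiv y a) (Φ.toEquiv z b)) ∧
      Φ.toEquiv Conf.empty A.one = symOne (densBundle E M).fib :=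
  ⟨densIso E M, densAlgebra E M, fun h a b => densEquiv_mul h a b, densEquiv_one⟩
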